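/- Let $L:=L^2(0,1)$ (real-valued) and let $\mu^{BB}$ be the law on $L$ of the Brownian bridge from $0$ to $0$, i.e. the centered Gaussian measure on $L$ with covariance operator $(Q\eta)_t=\int_0^1 (t\wedge s-ts)\,\eta_s\,ds$. Let $$\mathcal{F}C_b^\infty(L):=\{g((\eta_1,\cdot)_L,\dots,(\eta_k,\cdot)_L) : k\in\mathbb{N},\ g\in C_b^\infty(\mathbb{R}^k),\ \eta_1,\dots,\eta_k\in L\},$$ where $C_b^\infty(\mathbb{R}^k)$ is the space of smooth real functions that are bounded together with all their derivatives, and let $\exp(L)$ (resp. $\exp(C^\infty)$) be the real linear span of the functions $\sin((\eta,\cdot)_L)$ and $\cos((\eta,\cdot)_L)$ with $\eta\in L$ (resp. $\eta\in C^\infty[0,1]$). For differentiable $F:L\to\mathbb{R}$ let $\nabla F:L\to L$ be its Fr\'echet gradient. The Sobolev space $W^{1,2}(L;\mu^{BB})$ with its weak gradient, again denoted by $\nabla$, is obtained by closing the operator $\exp(L)\ni F\mapsto\nabla F$ from $L^2(L;\mu^{BB})$ to $L^2(L;\mu^{BB};L)$, and carries the norm $\|u\|_{W^{1,2}}^2=\|u\|^2_{L^2(L;\mu^{BB})}+\|\nabla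 u\|^2_{L^2(L;\mu^{BB};L)}$. The operator is closable, so that the weak gradient is well defined, and: (i) For every $F\in\mathcal{F}C_b^\infty(L)$ the function $F\circ|\cdot|$, $f\mapsto F(|f|)$, belongs to $W^{1,2}(L;\mu^{BB})$, and its weak gradient is $\nabla(F\circ|\cdot|)(f)=\mathrm{sgn}(f)\,\nabla F(|f|)$ for $\mu^{BB}$-a.e. $f\in L$. (ii) $\exp(C^\infty)$ is (contained and) dense in $W^{1,2}(L;\mu^{BB})$. -/

import Mathlib

open MeasureTheory ProbabilityTheory Filter Topology
open scoped RealInnerProductSpace ENNReal Gradient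

/-- Lebesgue measure on the interval `(0, 1)`. -/
noncomputable abbrev vol01 : Measure ℝ := volume.restrict (Set.Ioo 0 1)

/-- The real Hilbert space `L = L²(0, 1)`, with its Borel σ-algebra. -/
noncomputable abbrev L01 : Type := Lp ℝ 2 vol01

noncomputable instance : MeasurableSpace L01 := borel L01

instance : BorelSpace L01 := ⟨rfl⟩

instance : SecondCountableTopology L01 :=
  haveI : Fact ((2 : ℝ≥0∞) ≠ ∞) := ⟨by simp⟩
  inferInstanceAs (SecondCountableTopology (Lp ℝ 2 vol01))

/-- `μ` is the law on `L²(0, 1)` of a Brownian bridge from `0` to `0`: the centered Gaussian measure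
whose covariance operator is `(Q η)_t = ∫₀¹ (t ∧ s - t s) η_s ds`, i.e. the covariance of
`(η, ·)` and `(ξ, ·)` under `μ` is `(Q η, ξ)`. -/
structure IsBrownianBridgeLaw (μ : Measure L01) : Prop where
  isGaussian : IsGaussian μ
  mean_eq_zero : ∫ f, f ∂μ = 0
  covariance_eq : ∀ η ξ : L01, covarianceBilin μ η ξ =
    ∫ t, (∫ s, (min t s - t * s) * η s ∂vol01) * ξ t ∂vol01

theorem IsBrownianBridgeLaw.unique {μ ν : Measure L01} (hμ : IsBrownianBridgeLaw μ)
    (hν : IsBrownianBridgeLaw ν) : μ = ν := by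
  have := hμ.isGaussian
  have := hν.isGaussian
  refine IsGaussian.ext ?_ ?_
  · exact hμ.mean_eq_zero.trans hν.mean_eq_zero.symm
  · ext η ξ
    rw [hμ.covariance_eq, hν.covariance_eq]

/-! Auxiliary: Gaussian series in a Hilbert space, used to show that the Brownian bridge law exists. -/

theorem exists_bilin_hasSum {E : Type*} [NormedAddCommGroup E] [InnerProductSpace ℝ E]
    (a : ℕ → E) (ha : Summable fun n => ‖a n‖ ^ 2) :
    ∃ B : E →L[ℝ] E →L[ℝ] ℝ, ∀ x y, HasSum (fun n => ⟪a n, x⟫ * ⟪a n, y⟫) (B x y) := by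
  have hbd : ∀ x y n, ‖⟪a n, x⟫ * ⟪a n, y⟫‖ ≤ ‖a n‖ ^ 2 * (‖x‖ * ‖y‖) := fun x y n => by
    rw [norm_mul]
    calc ‖⟪a n, x⟫‖ * ‖⟪a n, y⟫‖ ≤ (‖a n‖ * ‖x‖) * (‖a n‖ * ‖y‖) := by
          gcongr <;> exact norm_inner_le_norm _ _
      _ = _ := by ring
  have hs : ∀ x y, Summable fun n => ⟪a n, x⟫ * ⟪a n, y⟫ := fun x y =>
    Summable.of_norm_bounded (ha.mul_right _) (hbd x y)
  let B₀ : E →ₗ[ℝ] E →ₗ[ℝ] ℝ := LinearMap.mk₂ ℝ (fun x y => ∑' n, ⟪a n, x⟫ * ⟪a n, y⟫)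
    (fun x x' y => by
      rw [← (hs x y).tsum_add (hs x' y)]
      exact tsum_congr fun n => by rw [inner_add_right]; ring)
    (fun c x y => by
      rw [smul_eq_mul, ← tsum_mul_left]
      exact tsum_congr fun n => by rw [real_inner_smul_right]; ring)
    (fun x y y' => by
      rw [← (hs x y).tsum_add (hs x y')]
      exact tsum_congr fun n => by rw [inner_add_right]; ring)
    (fun c x y => by
      rw [smul_eq_mul, ← tsum_mul_left]
      exact tsum_congr fun n => by rw [real_inner_smul_right]; ring)
  refine ⟨B₀.mkContinuous₂ (∑' n, ‖a n‖ ^ 2) fun x y => ?_, fun x y => (hs x y).hasSum⟩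
  have h := tsum_of_norm_bounded (ha.hasSum.mul_right (‖x‖ * ‖y‖)) (hbd x y)
  simpa [B₀, mul_assoc] using h

theorem exists_gaussian_series {E : Type*} [NormedAddCommGroup E] [InnerProductSpace ℝ E]
    [CompleteSpace E] [SecondCountableTopology E] [MeasurableSpace E] [BorelSpace E]
    (a : ℕ → E) (ha : Summable fun n => ‖a n‖ ^ 2) :
    ∃ μ : Measure E, IsGaussian μ ∧ ∫ x, x ∂μ = 0 ∧
      ∀ x y, HasSum (fun n => ⟪a n, x⟫ * ⟪a n, y⟫) (covarianceBilin μ x y) := by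
  classical
  set P : Measure (ℕ → ℝ) := Measure.infinitePi fun _ : ℕ => gaussianReal 0 1 with hP
  have hmp : ∀ n, MeasurePreserving (fun ω : ℕ → ℝ => ω n) P (gaussianReal 0 1) :=
    fun n => measurePreserving_eval_infinitePi _ n
  have hind : iIndepFun (fun n (ω : ℕ → ℝ) => ω n) P :=
    iIndepFun_infinitePi (X := fun _ x => x) (fun _ => measurable_id)
  have hL2 : ∀ n, MemLp (fun ω : ℕ → ℝ => ω n) 2 P := fun n =>
    (memLp_id_gaussianReal 2).comp_measurePreserving (hmp n)
  have hmean : ∀ n, ∫ ω, ω n ∂P = 0 := fun n => by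
    have h := integral_map (μ := P) (φ := fun ω : ℕ → ℝ => ω n)
      (f := fun x : ℝ => x)
      (hmp n).measurable.aemeasurable (by fun_prop)
    rw [(hmp n).map_eq, integral_id_gaussianReal] at h
    exact h.symm
  have hsq : ∀ n, ∫ ω, ω n * ω n ∂P = 1 := fun n => by
    have h := integral_map (μ := P) (φ := fun ω : ℕ → ℝ => ω n)
      (f := fun x : ℝ => x * x)
      (hmp n).measurable.aemeasurable (by fun_prop)
    rw [(hmp n).map_eq] at h
    rw [← h]
    have hv := variance_fun_id_gaussianReal (μ := 0) (v := 1)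
    rw [variance_of_integral_eq_zero (by fun_prop) integral_id_gaussianReal] at hv
    simpa [sq] using hv
  have hcross : ∀ m n, m ≠ n → ∫ ω, ω m * ω n ∂P = 0 := fun m n hmn => by
    rw [(hind.indepFun hmn).integral_fun_mul_eq_mul_integral
      (hL2 m).1 (hL2 n).1, hmean, zero_mul]
  have hfm : ∀ n, MemLp (fun ω : ℕ → ℝ => ω n • a n) 2 P := fun n =>
    ((ContinuousLinearMap.id ℝ ℝ).smulRight (a n)).comp_memLp' (hL2 n)
  let f : ℕ → Lp E 2 P := fun n => (hfm n).toLp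
  have hfi : ∀ m n, ⟪f m, f n⟫ = (∫ ω, ω m * ω n ∂P) * ⟪a m, a n⟫ := fun m n => by
    rw [L2.inner_def, ← integral_mul_const]
    refine integral_congr_ae ?_
    filter_upwards [(hfm m).coeFn_toLp, (hfm n).coeFn_toLp] with ω h1 h2
    simp only [f, h1, h2, inner_smul_left, inner_smul_right]
    simp; ring
  have hfsum : Summable f := by
    have hV : OrthogonalFamily ℝ (fun n => Submodule.span ℝ {f n})
        (fun n => (Submodule.span ℝ {f n}).subtypeₗᵢ) := by
      refine OrthogonalFamily.of_pairwise fun m n hmn => ?_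
      change Submodule.span ℝ {f m} ⟂ Submodule.span ℝ {f n}
      rw [Submodule.isOrtho_span]
      rintro u rfl v rfl
      rw [hfi, hcross m n hmn, zero_mul]
    have := (hV.summable_iff_norm_sq_summable
      fun n => ⟨f n, Submodule.mem_span_singleton_self _⟩).2 (by
        refine ha.congr fun n => ?_
        simp only [Submodule.coe_norm]
        rw [← real_inner_self_eq_norm_sq, ← real_inner_self_eq_norm_sq, hfi, hsq, one_mul])
    exact this
  set X : Lp E 2 P := ∑' n, f n
  have hXm : AEMeasurable X P := (Lp.aestronglyMeasurable X).aemeasurable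
  have hlim : Tendsto (fun N => ∑ n ∈ Finset.range N, f n) atTop (𝓝 X) :=
    hfsum.hasSum.tendsto_sum_nat
  obtain ⟨ns, hns, hae⟩ := (tendstoInMeasure_of_tendsto_Lp hlim).exists_seq_tendsto_ae
  have hpart : ∀ N, (∑ n ∈ Finset.range N, f n : Lp E 2 P) =ᵐ[P]
      fun ω => ∑ n ∈ Finset.range N, ω n • a n := fun N => by
    have h1 := Lp.coeFn_finsetSum (Finset.range N) f
    have h2 : ∀ᵐ ω ∂P, ∀ n, f n ω = ω n • a n :=
      ae_all_iff.2 fun n => (hfm n).coeFn_toLp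
    filter_upwards [h1, h2] with ω h1 h2
    rw [h1, Finset.sum_apply]
    exact Finset.sum_congr rfl fun n _ => h2 n
  obtain ⟨B, hBs⟩ := exists_bilin_hasSum a ha
  have hBpos : B.toBilinForm.IsPosSemidef := by
    refine ⟨⟨fun x y => ?_⟩, ⟨fun x => ?_⟩⟩
    · simpa using (hBs x y).unique ((hBs y x).congr_fun fun n => mul_comm _ _)
    · exact (hBs x x).nonneg fun n => mul_self_nonneg _
  have : IsProbabilityMeasure (P.map X) := Measure.isProbabilityMeasure_map hXm
  have hchar : ∀ t, charFun (P.map X) t = Complex.exp (⟪t, (0 : E)⟫ * Complex.I - B t t / 2) := by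
    intro t
    rw [charFun_apply, integral_map hXm (by fun_prop)]
    have hS : ∀ N, ∫ ω, Complex.exp (⟪∑ n ∈ Finset.range N, ω n • a n, t⟫ * Complex.I) ∂P
        = Complex.exp (-((∑ n ∈ Finset.range N, ⟪a n, t⟫ * ⟪a n, t⟫ : ℝ) : ℂ) / 2) := by
      intro N
      have hi := (hind.precomp (g := fun i : Fin N => (i : ℕ)) Fin.val_injective).integral_fun_prod_comp
        (f := fun (i : Fin N) (x : ℝ) => Complex.exp ((⟪a i, t⟫ * x : ℝ) * Complex.I))
        (fun i => (hmp i).measurable.aemeasurable) (fun i => by fun_prop)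
      have he : ∀ i : Fin N, ∫ ω, Complex.exp ((⟪a i, t⟫ * ω i : ℝ) * Complex.I) ∂P
          = Complex.exp (-((⟪a i, t⟫ * ⟪a i, t⟫ : ℝ) : ℂ) / 2) := fun i => by
        have h := integral_map (μ := P) (φ := fun ω : ℕ → ℝ => ω i)
          (f := fun x : ℝ => Complex.exp ((⟪a i, t⟫ * x : ℝ) * Complex.I))
          (hmp i).measurable.aemeasurable (by fun_prop)
        rw [← h, (hmp i).map_eq]
        have hc := charFun_gaussianReal (μ := 0) (v := 1) ⟪a i, t⟫
        rw [charFun_apply_real] at hc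
        push_cast
        rw [hc]
        simp [sq, neg_div]
      simp_rw [he, ← Complex.exp_sum] at hi
      refine Eq.trans (integral_congr_ae (ae_of_all _ fun ω => ?_)) (hi.trans ?_)
      · dsimp only
        congr 1
        rw [← Finset.sum_mul, ← Complex.ofReal_sum,
          Fin.sum_univ_eq_sum_range (fun n => ⟪a n, t⟫ * ω n), sum_inner]
        congr 2
        exact Finset.sum_congr rfl fun n _ => by rw [real_inner_smul_left, mul_comm]
      · congr 1
        rw [← Finset.sum_div, Finset.sum_neg_distrib, ← Complex.ofReal_sum,
          Fin.sum_univ_eq_sum_range (fun n => ⟪a n, t⟫ * ⟪a n, t⟫)]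
    have hl1 : Tendsto (fun k => ∫ ω, Complex.exp
        (⟪∑ n ∈ Finset.range (ns k), ω n • a n, t⟫ * Complex.I) ∂P) atTop
        (𝓝 (∫ ω, Complex.exp (⟪X ω, t⟫ * Complex.I) ∂P)) := by
      refine tendsto_integral_of_dominated_convergence (fun _ => 1) ?_ ?_ ?_ ?_
      · intro k
        refine Measurable.aestronglyMeasurable ?_
        fun_prop
      · exact integrable_const _
      · intro k; filter_upwards with ω
        rw [Complex.norm_exp_ofReal_mul_I]
      · filter_upwards [hae, ae_all_iff.2 hpart] with ω h1 h2
        simp_rw [h2] at h1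
        have := (Complex.continuous_exp.comp ((Complex.continuous_ofReal.comp
          (continuous_id.inner (continuous_const (y := t)))).mul (continuous_const (y := Complex.I)))).tendsto (X ω)
        exact this.comp h1
    have hl2 : Tendsto (fun k => Complex.exp
        (-((∑ n ∈ Finset.range (ns k), ⟪a n, t⟫ * ⟪a n, t⟫ : ℝ) : ℂ) / 2)) atTop
        (𝓝 (Complex.exp (-((B t t : ℝ) : ℂ) / 2))) := by
      have h1 := (hBs t t).tendsto_sum_nat.comp hns.tendsto_atTop
      have h2 : Continuous fun r : ℝ => Complex.exp (-(r : ℂ) / 2) := by fun_prop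
      exact (h2.tendsto _).comp h1
    simp_rw [hS] at hl1
    rw [tendsto_nhds_unique hl1 hl2]
    simp [neg_div]
  have hG : IsGaussian (P.map X) := isGaussian_iff_gaussian_charFun.2 ⟨0, B, hBpos, hchar⟩
  obtain ⟨h0, hB'⟩ := gaussian_charFun_congr 0 B hBpos hchar
  exact ⟨P.map X, hG, h0.symm, fun x y => hB' ▸ hBs x y⟩

/-- Sine expansion of the Brownian bridge covariance. -/
theorem kernel_hasSum {s t : ℝ} (hs : s ∈ Set.Ioo (0 : ℝ) 1) (ht : t ∈ Set.Ioo (0 : ℝ) 1) :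
    HasSum (fun n : ℕ => √2 * Real.sin (n * Real.pi * t) / (n * Real.pi) *
      (√2 * Real.sin (n * Real.pi * s) / (n * Real.pi))) (min t s - t * s) := by
  wlog hst : s ≤ t generalizing s t
  · have := this ht hs (le_of_not_ge hst)
    rw [min_comm, mul_comm t s]
    exact this.congr_fun fun n => mul_comm _ _
  have h1 := hasSum_one_div_nat_pow_mul_cos one_ne_zero
    (x := (t - s) / 2) ⟨by linarith, by linarith [hs.1, ht.2]⟩
  have h2 := hasSum_one_div_nat_pow_mul_cos one_ne_zero
    (x := (t + s) / 2) ⟨by linarith [hs.1, ht.1], by linarith [hs.2, ht.2]⟩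
  have hb : ∀ x : ℝ, (Polynomial.map (algebraMap ℚ ℝ) (Polynomial.bernoulli (2 * 1))).eval x
      = x ^ 2 - x + 1 / 6 := by
    intro x
    simp only [mul_one, Polynomial.bernoulli, Finset.sum_range_succ, Finset.sum_range_zero]
    rw [bernoulli_one, bernoulli_eq_bernoulli'_of_ne_one (by decide : 2 ≠ 1), bernoulli'_two]
    simp
    ring
  rw [hb] at h1 h2
  have h3 := (h1.sub h2).mul_left (1 / Real.pi ^ 2)
  refine (congr_arg₂ HasSum ?_ ?_).to_iff.mp h3
  · funext n
    have e1 : 2 * Real.pi * n * ((t - s) / 2) = n * Real.pi * t - n * Real.pi * s := by ring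
    have e2 : 2 * Real.pi * n * ((t + s) / 2) = n * Real.pi * t + n * Real.pi * s := by ring
    rw [e1, e2, Real.cos_sub, Real.cos_add]
    have h2 : √2 * √2 = (2 : ℝ) := Real.mul_self_sqrt (by norm_num)
    generalize Real.sin (n * Real.pi * t) = A
    generalize Real.sin (n * Real.pi * s) = B
    rcases eq_or_ne (n : ℝ) 0 with h | h
    · simp [h]
    have := Real.pi_ne_zero
    field_simp
    linear_combination -(n : ℝ) ^ 2 * A * B * h2
  · rw [min_eq_right hst]
    have := Real.pi_ne_zero
    simp
    field_simp
    ring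

theorem exists_isBrownianBridgeLaw : ∃ μ : Measure L01, IsBrownianBridgeLaw μ := by
  let φ : ℕ → ℝ → ℝ := fun n t => √2 * Real.sin (n * Real.pi * t) / (n * Real.pi)
  have hφc : ∀ n, Continuous (φ n) := fun n => by fun_prop
  let C : ℕ → ℝ := fun n => √2 / Real.pi * (1 / n)
  have hC0 : ∀ n, 0 ≤ C n := fun n => by positivity
  have hφb : ∀ n t, ‖φ n t‖ ≤ C n := fun n t => by
    simp only [φ, C, norm_div, norm_mul, Real.norm_eq_abs]
    rw [abs_of_nonneg (Real.sqrt_nonneg 2), abs_of_nonneg Real.pi_pos.le,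
      abs_of_nonneg (Nat.cast_nonneg n : (0 : ℝ) ≤ n), div_mul_div_comm, mul_comm Real.pi]
    gcongr
    exact Real.abs_sin_le_one _
  have hφm : ∀ n, MemLp (φ n) 2 vol01 := fun n =>
    MemLp.of_bound (hφc n).aestronglyMeasurable (C n) (ae_of_all _ (hφb n))
  let a : ℕ → L01 := fun n => (hφm n).toLp
  have hCs : Summable fun n => C n ^ 2 := by
    simp only [C, mul_pow]
    refine Summable.mul_left _ ?_
    simp
  have hin : ∀ n (x : L01), ⟪a n, x⟫ = ∫ t, φ n t * x t ∂vol01 := fun n x => by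
    rw [L2.inner_def]
    refine integral_congr_ae ?_
    filter_upwards [(hφm n).coeFn_toLp] with t ht
    simp only [a, ht]
    simp [mul_comm]
  have ha : Summable fun n => ‖a n‖ ^ 2 := by
    refine hCs.of_nonneg_of_le (fun n => by positivity) fun n => ?_
    have h : ‖a n‖ ≤ C n := by
      have := Lp.norm_le_of_ae_bound (f := a n) (hC0 n) (by
        filter_upwards [(hφm n).coeFn_toLp] with t ht
        simp only [a, ht]; exact hφb n t)
      simpa [measureUnivNNReal] using this
    gcongr
  obtain ⟨μ, h1, h2, h3⟩ := exists_gaussian_series a ha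
  refine ⟨μ, h1, h2, fun η ξ => (h3 η ξ).unique ?_⟩
  have hint : ∀ x : L01, Integrable x vol01 := fun x =>
    (Lp.memLp x).integrable (by norm_num)
  have hg : Integrable (fun p : ℝ × ℝ => ξ p.1 * η p.2) (vol01.prod vol01) :=
    (hint ξ).mul_prod (hint η)
  let F : ℕ → ℝ × ℝ → ℝ := fun n p => (φ n p.1 * φ n p.2) * (ξ p.1 * η p.2)
  have hFb : ∀ n (p : ℝ × ℝ), ‖φ n p.1 * φ n p.2‖ ≤ C n ^ 2 := fun n p => by
    rw [norm_mul, sq]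
    exact mul_le_mul (hφb _ _) (hφb _ _) (norm_nonneg _) (hC0 n)
  have hFi : ∀ n, Integrable (F n) (vol01.prod vol01) := fun n =>
    hg.bdd_mul (c := C n ^ 2) (by fun_prop) (ae_of_all _ (hFb n))
  have hFs : Summable fun n => ∫ p, ‖F n p‖ ∂(vol01.prod vol01) := by
    refine (hCs.mul_right (∫ p, ‖ξ p.1 * η p.2‖ ∂(vol01.prod vol01))).of_nonneg_of_le
      (fun n => integral_nonneg fun _ => norm_nonneg _) fun n => ?_
    rw [← integral_const_mul]
    refine integral_mono (hFi n).norm (hg.norm.const_mul _) fun p => ?_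
    simp only [F]
    rw [norm_mul]
    exact mul_le_mul_of_nonneg_right (hFb n p) (norm_nonneg _)
  have key := hasSum_integral_of_summable_integral_norm hFi hFs
  have hmem : ∀ᵐ p ∂(vol01.prod vol01), p.1 ∈ Set.Ioo (0 : ℝ) 1 ∧ p.2 ∈ Set.Ioo (0 : ℝ) 1 := by
    rw [Measure.prod_restrict]
    exact ae_restrict_mem (measurableSet_Ioo.prod measurableSet_Ioo)
  have hK : (fun p => ∑' n, F n p) =ᵐ[vol01.prod vol01]
      fun p => ((min p.1 p.2 - p.1 * p.2) * η p.2) * ξ p.1 := by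
    filter_upwards [hmem] with p hp
    simp only [F]
    rw [tsum_mul_right, (kernel_hasSum hp.2 hp.1).tsum_eq]
    ring
  have hKi : Integrable (fun p : ℝ × ℝ => ((min p.1 p.2 - p.1 * p.2) * η p.2) * ξ p.1)
      (vol01.prod vol01) := by
    have : Integrable (fun p : ℝ × ℝ => (min p.1 p.2 - p.1 * p.2) * (ξ p.1 * η p.2))
        (vol01.prod vol01) := by
      refine hg.bdd_mul (c := 1) (by fun_prop) ?_
      filter_upwards [hmem] with p hp
      rw [Real.norm_eq_abs, abs_le]
      obtain ⟨⟨a1, a2⟩, b1, b2⟩ := hp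
      constructor
      · have := le_min a1.le b1.le
        nlinarith
      · have := min_le_left p.1 p.2
        nlinarith
    exact this.congr (ae_of_all _ fun p => by ring)
  rw [integral_congr_ae hK, integral_prod _ hKi] at key
  simp only [integral_mul_const] at key
  refine key.congr_fun fun n => ?_
  simp only [F]
  rw [hin, hin, mul_comm, ← integral_prod_mul]
  exact integral_congr_ae (ae_of_all _ fun p => by simp only; ring)

/-- The law `μ^{BB}` of the Brownian bridge on `L²(0, 1)`; it is unique by
`IsBrownianBridgeLaw.unique`. -/
noncomputable def brownianBridgeLaw : Measure L01 := exists_isBrownianBridgeLaw.choose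

theorem isBrownianBridgeLaw_brownianBridgeLaw : IsBrownianBridgeLaw brownianBridgeLaw :=
  exists_isBrownianBridgeLaw.choose_spec

/-- `C_b^∞(ℝᵏ)`: smooth functions that are bounded together with all their derivatives. -/
def IsCbInfty {k : ℕ} (g : (Fin k → ℝ) → ℝ) : Prop :=
  ContDiff ℝ (⊤ : ℕ∞) g ∧ ∀ n : ℕ, ∃ C : ℝ, ∀ x, ‖iteratedFDeriv ℝ n g x‖ ≤ C

/-- `FC_b^∞(L)`: the functions `f ↦ g((η₁, f), …, (η_k, f))` with `g ∈ C_b^∞(ℝᵏ)`, `η_i ∈ L`. -/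
def cylindricalCbInfty : Set (L01 → ℝ) :=
  {F | ∃ (k : ℕ) (g : (Fin k → ℝ) → ℝ) (η : Fin k → L01),
    IsCbInfty g ∧ F = fun f => g fun i => ⟪η i, f⟫}

/-- The linear span of the functions `sin((η, ·))`, `cos((η, ·))` with `η ∈ S`. -/
def trigSpan (S : Set L01) : Submodule ℝ (L01 → ℝ) :=
  Submodule.span ℝ
    ({F | ∃ η ∈ S, F = fun f => Real.sin ⟪η, f⟫} ∪ {F | ∃ η ∈ S, F = fun f => Real.cos ⟪η, f⟫})

/-- `exp(L)`. -/
def expL : Submodule ℝ (L01 → ℝ) := trigSpan Set.univ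

/-- `C^∞[0, 1]`, as a subset of `L`. -/
def smooth01 : Set L01 :=
  {η | ∃ φ : ℝ → ℝ, ContDiffOn ℝ (⊤ : ℕ∞) φ (Set.Icc 0 1) ∧ η =ᵐ[vol01] φ}

/-- `exp(C^∞)`. -/
def expSmooth : Submodule ℝ (L01 → ℝ) := trigSpan smooth01

/-- `v` is a weak gradient of `u`: the pair `(u, v)` lies in the closure, in
`L²(L; μ^{BB}) × L²(L; μ^{BB}; L)`, of the graph `{(F, ∇F) | F ∈ exp(L)}` of the
Fréchet gradient. -/
def HasWeakGradient (u : Lp ℝ 2 brownianBridgeLaw) (v : Lp L01 2 brownianBridgeLaw) : Prop :=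
  (u, v) ∈ closure {p : Lp ℝ 2 brownianBridgeLaw × Lp L01 2 brownianBridgeLaw |
    ∃ F ∈ expL, p.1 =ᵐ[brownianBridgeLaw] F ∧ p.2 =ᵐ[brownianBridgeLaw] ∇ F}

/-- The Sobolev space `W^{1,2}(L; μ^{BB})`, the domain of the closure of the gradient form
`(F, G) ↦ ½ ∫ (∇F, ∇G) dμ^{BB}` on `exp(L)`. -/
def sobolevW12 : Set (Lp ℝ 2 brownianBridgeLaw) := {u | ∃ v, HasWeakGradient u v}

open Classical in
/-- The weak gradient of `u ∈ W^{1,2}(L; μ^{BB})` (and `0` for other `u`). -/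
noncomputable def weakGradient (u : Lp ℝ 2 brownianBridgeLaw) : Lp L01 2 brownianBridgeLaw :=
  if h : ∃ v, HasWeakGradient u v then h.choose else 0

/-- The norm of `W^{1,2}(L; μ^{BB})`. -/
noncomputable def sobolevNorm (u : Lp ℝ 2 brownianBridgeLaw) : ℝ :=
  √(‖u‖ ^ 2 + ‖weakGradient u‖ ^ 2)

/-! Uniqueness of the weak gradient rests on Gaussian integration by parts. If `R = Qη` lies in the
range of the covariance operator, then `∫ ⟪∇F, R⟫ G = ∫ F (⟪η, ·⟫ G - ⟪∇G, R⟫)` for trigonometric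
`F`, `G`. Both sides are continuous in `(F, ∇F)`, so every pair `(u, v)` in the closure inherits the
identity (`HasWeakGradient.integral_by_parts`). Thus `u` determines all trigonometric moments of
`⟪v, R⟫`, hence `⟪v, R⟫` itself, by injectivity of the characteristic function. The bridge kernel is
the Green function of `-d²/dt²` with zero boundary values, so each test function `φ` equals
`Q(-φ'')`; such `R` are dense, and `v` is unique.

For the density of `exp(C^∞)`: `cos(⟪ξ, ·⟫ + α)` and its gradient depend continuously in `L²` on
`ξ`, so every dense set of frequencies generates the same closure
(`topologicalClosure_trigGraph_of_dense`).

For the chain rule, `F ∘ |·|` is not cylindrical and is reached through a chain of limits. A smooth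
compactly supported function of finitely many coordinates is a Fourier superposition of plane waves,
so it lies in the closure together with its gradient (`isWeakGradient_of_hasCompactSupport`);
cutoffs replace compact support by boundedness (`isWeakGradient_of_bounded`). Let `P_n` average over
`n + 1` equal cells and let `φ` be smooth. Then `φ ∘ P_n f` is again a step function, so `F(φ ∘ P_n
f)` depends smoothly on `n + 1` coordinates, with gradient `P_n(φ'(P_n f) ∇F(φ ∘ P_n f))`. Now `n →
∞`, and afterwards `φ` tends to the absolute value. In each limit the functions and gradients
converge at every `f` under a uniform bound, so dominated convergence applies
(`IsWeakGradient.of_tendsto`). The derivatives of the smooth approximants converge to the sign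
everywhere, including at `0`, so nothing about the zeros of the bridge is needed. -/

section GaussianHilbert

/-! ### Gaussian integration by parts and trigonometric moments. -/

set_option linter.unusedSectionVars false

variable {E : Type*} [NormedAddCommGroup E] [InnerProductSpace ℝ E] [CompleteSpace E]
  [SecondCountableTopology E] [MeasurableSpace E] [BorelSpace E]

theorem integrable_sin_inner_add (μ : Measure E) [IsFiniteMeasure μ] (ξ : E) (α : ℝ) :
    Integrable (fun x => Real.sin (⟪ξ, x⟫ + α)) μ :=
  Integrable.of_bound (by fun_prop) 1 (ae_of_all _ fun x => by
    simpa using Real.abs_sin_le_one _)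

theorem memLp_inner_of_isGaussian (μ : Measure E) [IsGaussian μ] (η : E) :
    MemLp (fun x => ⟪η, x⟫) 2 μ :=
  IsGaussian.memLp_dual μ (innerSL ℝ η) 2 (by simp)

theorem integrable_inner_mul_cos (μ : Measure E) [IsGaussian μ] (ξ η : E) (α : ℝ) :
    Integrable (fun x => ⟪η, x⟫ * Real.cos (⟪ξ, x⟫ + α)) μ :=
  ((memLp_inner_of_isGaussian μ η).integrable (by norm_num)).mul_bdd (c := 1) (by fun_prop)
    (ae_of_all _ fun x => by simpa using Real.abs_cos_le_one _)

/-- Imaginary part of the characteristic function at `ξ` multiplied by `exp(iα)`. -/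
theorem integral_sin_inner_add (μ : Measure E) [IsGaussian μ] (h0 : ∫ x, x ∂μ = 0)
    (ξ : E) (α : ℝ) :
    ∫ x, Real.sin (⟪ξ, x⟫ + α) ∂μ = Real.sin α * Real.exp (-(covarianceBilin μ ξ ξ) / 2) := by
  have h := IsGaussian.charFun_eq' (μ := μ) ξ
  have h0' : ∫ x, id x ∂μ = 0 := h0
  rw [h0', charFun_apply] at h
  have hi : Integrable (fun x => Complex.exp (⟪x, ξ⟫ * Complex.I)) μ :=
    Integrable.of_bound (by fun_prop) 1 (ae_of_all _ fun x => by
      rw [Complex.norm_exp_ofReal_mul_I])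
  have h2 : ∫ x, Complex.exp (⟪x, ξ⟫ * Complex.I) * Complex.exp (α * Complex.I) ∂μ =
      ((Real.exp (-(covarianceBilin μ ξ ξ) / 2) : ℝ) : ℂ) * Complex.exp (α * Complex.I) := by
    rw [integral_mul_const, h]
    simp [neg_div]
  have h3 := congrArg Complex.im h2
  rw [← RCLike.im_eq_complex_im, ← integral_im (hi.mul_const _), RCLike.im_eq_complex_im,
    Complex.im_ofReal_mul, Complex.exp_ofReal_mul_I_im] at h3
  rw [mul_comm, ← h3]
  refine integral_congr_ae (ae_of_all _ fun x => ?_)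
  simp only
  rw [← Complex.exp_add, ← add_mul, ← Complex.ofReal_add, Complex.exp_ofReal_mul_I_im,
    real_inner_comm]

/-- Both sides are the derivative at `s = 0` of `∫ sin(⟪ξ + s η, x⟫ + α) dμ`: on the left taken
under the integral with majorant `|⟪η, x⟫|`, on the right taken in the closed form of
`integral_sin_inner_add`. -/
theorem integral_inner_mul_cos (μ : Measure E) [IsGaussian μ] (h0 : ∫ x, x ∂μ = 0)
    (ξ η : E) (α : ℝ) :
    ∫ x, ⟪η, x⟫ * Real.cos (⟪ξ, x⟫ + α) ∂μ =
      -(covarianceBilin μ ξ η) * ∫ x, Real.sin (⟪ξ, x⟫ + α) ∂μ := by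
  have hin : ∀ (s : ℝ) x, ⟪ξ + s • η, x⟫ + α = ⟪ξ, x⟫ + s * ⟪η, x⟫ + α := fun s x => by
    rw [inner_add_left, real_inner_smul_left]
  have hd : ∀ x (s : ℝ), HasDerivAt (fun s : ℝ => Real.sin (⟪ξ + s • η, x⟫ + α))
      (⟪η, x⟫ * Real.cos (⟪ξ + s • η, x⟫ + α)) s := fun x s => by
    simp only [hin]
    have := ((((hasDerivAt_id s).mul_const ⟪η, x⟫).const_add ⟪ξ, x⟫).add_const α).sin
    simpa [mul_comm] using this
  have hb : ∀ x (s : ℝ), ‖⟪η, x⟫ * Real.cos (⟪ξ + s • η, x⟫ + α)‖ ≤ ‖⟪η, x⟫‖ := fun x s => by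
    rw [norm_mul]
    exact mul_le_of_le_one_right (norm_nonneg _) (by simpa using Real.abs_cos_le_one _)
  have h1 := (hasDerivAt_integral_of_dominated_loc_of_deriv_le (μ := μ) (x₀ := (0 : ℝ))
    (F := fun s x => Real.sin (⟪ξ + s • η, x⟫ + α))
    (F' := fun s x => ⟪η, x⟫ * Real.cos (⟪ξ + s • η, x⟫ + α))
    (bound := fun x => ‖⟪η, x⟫‖) (s := Set.univ) univ_mem
    (Eventually.of_forall fun s => (integrable_sin_inner_add μ _ α).1)
    (integrable_sin_inner_add μ _ α) (integrable_inner_mul_cos μ _ η α).1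
    (ae_of_all _ fun x s _ => hb x s)
    ((memLp_inner_of_isGaussian μ η).integrable (by norm_num)).norm
    (ae_of_all _ fun x s _ => hd x s)).2
  simp only [zero_smul, add_zero] at h1
  rw [integral_sin_inner_add μ h0]
  refine h1.unique ?_
  simp_rw [integral_sin_inner_add μ h0]
  have hq : ∀ s : ℝ, covarianceBilin μ (ξ + s • η) (ξ + s • η) = covarianceBilin μ ξ ξ
      + s * (2 * covarianceBilin μ ξ η) + s ^ 2 * covarianceBilin μ η η := fun s => by
    simp only [map_add, map_smul, add_apply, smul_apply,
      smul_eq_mul]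
    rw [covarianceBilin_comm η ξ]
    ring
  simp_rw [hq]
  have h2 := ((((((hasDerivAt_id (0 : ℝ)).mul_const (2 * covarianceBilin μ ξ η)).const_add
    (covarianceBilin μ ξ ξ)).add (((hasDerivAt_id (0 : ℝ)).pow 2).mul_const
      (covarianceBilin μ η η))).neg.div_const 2).exp).const_mul (Real.sin α)
  refine (h2.congr_deriv ?_)
  simp
  ring

/-- Gaussian integration by parts for products of two trigonometric functions. -/
theorem integral_cos_mul_cos_by_parts (μ : Measure E) [IsGaussian μ] (h0 : ∫ x, x ∂μ = 0)
    (ξ ζ η : E) (α β : ℝ) :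
    ∫ x, Real.cos (⟪ξ, x⟫ + α) * (⟪η, x⟫ * Real.cos (⟪ζ, x⟫ + β)
        + covarianceBilin μ ζ η * Real.sin (⟪ζ, x⟫ + β)) ∂μ =
      ∫ x, -Real.sin (⟪ξ, x⟫ + α) * covarianceBilin μ ξ η * Real.cos (⟪ζ, x⟫ + β) ∂μ := by
  -- The product-to-sum formulas reduce everything to single waves with frequencies `ξ ± ζ`.
  have hp := integral_inner_mul_cos μ h0 (ξ + ζ) η (α + β)
  have hm := integral_inner_mul_cos μ h0 (ξ - ζ) η (α - β)
  have ip := integrable_inner_mul_cos μ (ξ + ζ) η (α + β)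
  have im := integrable_inner_mul_cos μ (ξ - ζ) η (α - β)
  have jp := integrable_sin_inner_add μ (ξ + ζ) (α + β)
  have jm := integrable_sin_inner_add μ (ξ - ζ) (α - β)
  have e : ∀ x, (⟪ξ + ζ, x⟫ + (α + β) = (⟪ξ, x⟫ + α) + (⟪ζ, x⟫ + β)) ∧
      (⟪ξ - ζ, x⟫ + (α - β) = (⟪ξ, x⟫ + α) - (⟪ζ, x⟫ + β)) := fun x => by
    rw [inner_add_left, inner_sub_left]; constructor <;> ring
  have k1 : ∫ x, Real.cos (⟪ξ, x⟫ + α) * (⟪η, x⟫ * Real.cos (⟪ζ, x⟫ + β)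
        + covarianceBilin μ ζ η * Real.sin (⟪ζ, x⟫ + β)) ∂μ = 
      (1 / 2) * (∫ x, ⟪η, x⟫ * Real.cos (⟪ξ + ζ, x⟫ + (α + β)) ∂μ) +
      (1 / 2) * (∫ x, ⟪η, x⟫ * Real.cos (⟪ξ - ζ, x⟫ + (α - β)) ∂μ) +
      (covarianceBilin μ ζ η / 2) * (∫ x, Real.sin (⟪ξ + ζ, x⟫ + (α + β)) ∂μ) -
      (covarianceBilin μ ζ η / 2) * (∫ x, Real.sin (⟪ξ - ζ, x⟫ + (α - β)) ∂μ) := by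
    simp_rw [← integral_const_mul]
    rw [← integral_add (ip.const_mul _) (im.const_mul _),
      ← integral_add (by exact (ip.const_mul _).add (im.const_mul _)) (jp.const_mul _),
      ← integral_sub (by exact ((ip.const_mul _).add (im.const_mul _)).add (jp.const_mul _))
        (jm.const_mul _)]
    refine integral_congr_ae (ae_of_all _ fun x => ?_)
    simp only [(e x).1, (e x).2, Real.cos_add, Real.cos_sub, Real.sin_add, Real.sin_sub]
    ring
  have k2 : ∫ x, -Real.sin (⟪ξ, x⟫ + α) * covarianceBilin μ ξ η * Real.cos (⟪ζ, x⟫ + β) ∂μ = 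
      (-covarianceBilin μ ξ η / 2) * (∫ x, Real.sin (⟪ξ + ζ, x⟫ + (α + β)) ∂μ) +
      (-covarianceBilin μ ξ η / 2) * (∫ x, Real.sin (⟪ξ - ζ, x⟫ + (α - β)) ∂μ) := by
    simp_rw [← integral_const_mul]
    rw [← integral_add (jp.const_mul _) (jm.const_mul _)]
    refine integral_congr_ae (ae_of_all _ fun x => ?_)
    simp only [(e x).1, (e x).2, Real.sin_add, Real.sin_sub]
    ring
  rw [k1, k2, hp, hm]
  simp only [map_add, map_sub, add_apply, sub_apply]
  ring

/-- An integrable function all of whose trigonometric moments vanish is zero. -/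
theorem ae_eq_zero_of_integral_mul_cos_eq_zero (μ : Measure E) [IsFiniteMeasure μ] {w : E → ℝ}
    (hw : Integrable w μ) (h : ∀ (ζ : E) (β : ℝ), ∫ x, w x * Real.cos (⟪ζ, x⟫ + β) ∂μ = 0) :
    w =ᵐ[μ] 0 := by
  have hwp : AEMeasurable (fun x => ENNReal.ofReal (w x)) μ := hw.1.aemeasurable.ennreal_ofReal
  have hwn : AEMeasurable (fun x => ENNReal.ofReal (-w x)) μ :=
    hw.1.aemeasurable.neg.ennreal_ofReal
  have fp : ∫⁻ x, ENNReal.ofReal (w x) ∂μ ≠ ∞ := hw.lintegral_lt_top.ne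
  have fn : ∫⁻ x, ENNReal.ofReal (-w x) ∂μ ≠ ∞ := hw.neg.lintegral_lt_top.ne
  have := isFiniteMeasure_withDensity fp
  have := isFiniteMeasure_withDensity fn
  -- The finite measures with densities `w⁺` and `w⁻` have the same characteristic function, hence
  -- coincide. The phases `0` and `-π/2` below supply its real and imaginary parts.
  have key : μ.withDensity (fun x => ENNReal.ofReal (w x)) =
      μ.withDensity (fun x => ENNReal.ofReal (-w x)) := by
    refine Measure.ext_of_charFun (funext fun t => ?_)
    rw [charFun_apply, charFun_apply,
      integral_withDensity_eq_integral_toReal_smul₀ hwp (ae_of_all _ fun x => by simp),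
      integral_withDensity_eq_integral_toReal_smul₀ hwn (ae_of_all _ fun x => by simp),
      ← sub_eq_zero]
    have hb : ∀ r : E → ℝ, Integrable r μ →
        Integrable (fun x => r x • Complex.exp (⟪x, t⟫ * Complex.I)) μ := fun r hr => by
      simp only [Complex.real_smul]
      exact (hr.ofReal (𝕜 := ℂ)).mul_bdd (c := 1) (by fun_prop) (ae_of_all _ fun x => by
        rw [Complex.norm_exp_ofReal_mul_I])
    rw [← integral_sub (hb _ (by simpa [ENNReal.toReal_ofReal'] using hw.pos_part))
      (hb _ (by simpa [ENNReal.toReal_ofReal'] using hw.neg_part))]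
    have hc : ∀ x, (ENNReal.ofReal (w x)).toReal • Complex.exp (⟪x, t⟫ * Complex.I) -
        (ENNReal.ofReal (-w x)).toReal • Complex.exp (⟪x, t⟫ * Complex.I) =
        ((w x * Real.cos (⟪t, x⟫ + 0) : ℝ) : ℂ) +
        ((w x * Real.cos (⟪t, x⟫ + -(Real.pi / 2)) : ℝ) : ℂ) * Complex.I := fun x => by
      rw [← sub_smul, ENNReal.toReal_ofReal', ENNReal.toReal_ofReal',
        max_zero_sub_max_neg_zero_eq_self, real_inner_comm,
        Complex.exp_mul_I, ← sub_eq_add_neg, Real.cos_sub_pi_div_two]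
      simp
      ring
    simp_rw [hc]
    have i1 : ∀ β : ℝ, Integrable (fun x => w x * Real.cos (⟪t, x⟫ + β)) μ := fun β =>
      hw.mul_bdd (c := 1) (by fun_prop) (ae_of_all _ fun x => by
        simpa using Real.abs_cos_le_one _)
    rw [integral_add (i1 0).ofReal ((i1 _).ofReal.mul_const _), integral_mul_const,
      integral_complex_ofReal, integral_complex_ofReal, h, h]
    simp
  have h2 := (withDensity_eq_iff hwp hwn fp).1 key
  filter_upwards [h2] with x hx
  have := congrArg ENNReal.toReal hx
  rw [ENNReal.toReal_ofReal', ENNReal.toReal_ofReal'] at this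
  rcases max_cases (w x) 0 with h1 | h1 <;> rcases max_cases (-w x) 0 with h2 | h2 <;>
    simp only [Pi.zero_apply] <;> linarith

end GaussianHilbert

/-! ### Test functions and the range of the covariance operator. -/

instance : IsGaussian brownianBridgeLaw := isBrownianBridgeLaw_brownianBridgeLaw.isGaussian

/-- Classes of smooth functions with compact support in `(0, 1)`. -/
noncomputable def testFunctions01 : Submodule ℝ L01 where
  carrier := {η | ∃ φ : ℝ → ℝ, ContDiff ℝ (⊤ : ℕ∞) φ ∧ tsupport φ ⊆ Set.Ioo 0 1 ∧ η =ᵐ[vol01] φ}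
  zero_mem' := ⟨0, contDiff_const, by simp [tsupport], Lp.coeFn_zero _ _ _⟩
  add_mem' := by
    rintro a b ⟨φ, h1, h2, h3⟩ ⟨ψ, k1, k2, k3⟩
    refine ⟨φ + ψ, h1.add k1, ?_, (Lp.coeFn_add a b).trans (h3.add k3)⟩
    exact (tsupport_add φ ψ).trans (Set.union_subset h2 k2)
  smul_mem' := by
    rintro c a ⟨φ, h1, h2, h3⟩
    refine ⟨c • φ, contDiff_const.smul h1, ?_, (Lp.coeFn_smul c a).trans (h3.const_smul c)⟩
    exact (tsupport_smul_subset_right (fun _ => c) φ).trans h2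

theorem hasCompactSupport_of_tsupport_subset_Ioo {φ : ℝ → ℝ} (h : tsupport φ ⊆ Set.Ioo 0 1) :
    HasCompactSupport φ :=
  isCompact_Icc.of_isClosed_subset (isClosed_tsupport φ) (h.trans Set.Ioo_subset_Icc_self)

theorem memLp_vol01_of_continuous {φ : ℝ → ℝ} (hφ : Continuous φ) : MemLp φ 2 vol01 := by
  obtain ⟨C, hC⟩ := isCompact_Icc.exists_bound_of_continuousOn (hφ.continuousOn (s := Set.Icc 0 1))
  refine MemLp.of_bound hφ.aestronglyMeasurable C ?_
  filter_upwards [ae_restrict_mem measurableSet_Ioo] with t ht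
  exact hC t (Set.Ioo_subset_Icc_self ht)

theorem inner_toLp_eq_integral {φ : ℝ → ℝ} (hφ : MemLp φ 2 vol01) (x : L01) :
    ⟪hφ.toLp, x⟫ = ∫ t, φ t * x t ∂vol01 := by
  rw [L2.inner_def]
  refine integral_congr_ae ?_
  filter_upwards [hφ.coeFn_toLp] with t ht
  rw [ht]
  simp [mul_comm]

/-- A vector orthogonal to all test functions vanishes, by the fundamental lemma of the calculus of
variations. -/
theorem dense_testFunctions01 : Dense (testFunctions01 : Set L01) := by
  rw [Submodule.dense_iff_topologicalClosure_eq_top, Submodule.topologicalClosure_eq_top_iff,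
    Submodule.eq_bot_iff]
  intro x hx
  have hloc : LocallyIntegrableOn x (Set.Ioo 0 1) volume :=
    IntegrableOn.locallyIntegrableOn ((Lp.memLp x).integrable (by norm_num))
  have h := isOpen_Ioo.ae_eq_zero_of_integral_contDiff_smul_eq_zero hloc (fun g hg hc hs => by
    have hm := memLp_vol01_of_continuous hg.continuous
    have h1 : ⟪hm.toLp, x⟫ = 0 := hx _ ⟨g, hg, hs, hm.coeFn_toLp⟩
    rw [inner_toLp_eq_integral] at h1
    rw [← h1]
    refine (setIntegral_eq_integral_of_forall_compl_eq_zero fun t ht => ?_).symm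
    rw [image_eq_zero_of_notMem_tsupport (fun h => ht (hs h)), zero_smul])
  rw [Lp.eq_zero_iff_ae_eq_zero]
  exact (ae_restrict_iff' measurableSet_Ioo).2 h

/-- The Green function identity: `-φ''` is mapped to `φ` by the Brownian bridge covariance. -/
theorem integral_bridgeKernel_mul_deriv_deriv {φ : ℝ → ℝ} (hφ : ContDiff ℝ (⊤ : ℕ∞) φ)
    (h0 : φ 0 = 0) (h1 : φ 1 = 0) {t : ℝ} (ht : t ∈ Set.Ioo (0 : ℝ) 1) :
    ∫ s, (min t s - t * s) * -(deriv (deriv φ) s) ∂vol01 = φ t := by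
  have hd1 : ContDiff ℝ (⊤ : ℕ∞) (deriv φ) := (contDiff_infty_iff_deriv.1 hφ).2
  have hd2 : Continuous (deriv (deriv φ)) := ((contDiff_infty_iff_deriv.1 hd1).2).continuous
  have e1 : ∀ s, HasDerivAt φ (deriv φ s) s := fun s =>
    (hφ.differentiable (by simp) s).hasDerivAt
  have e2 : ∀ s, HasDerivAt (deriv φ) (deriv (deriv φ) s) s := fun s =>
    (hd1.differentiable (by simp) s).hasDerivAt
  have hc : Continuous fun s => (min t s - t * s) * -(deriv (deriv φ) s) := by fun_prop
  rw [← integral_Ioc_eq_integral_Ioo, ← intervalIntegral.integral_of_le zero_le_one,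
    ← intervalIntegral.integral_add_adjacent_intervals (b := t)
      (hc.intervalIntegrable _ _) (hc.intervalIntegrable _ _)]
  -- The kernel is `(1 - t) s` on `[0, t]` and `t (1 - s)` on `[t, 1]`. Integrating by parts once
  -- gives an explicit primitive on each piece; the terms in `φ'(t)` cancel, and those in `φ(t)`
  -- have weights `1 - t` and `t`.
  have i1 : ∫ s in (0 : ℝ)..t, (min t s - t * s) * -(deriv (deriv φ) s) =
      -((1 - t) * (t * deriv φ t - φ t)) - -((1 - t) * (0 * deriv φ 0 - φ 0)) := by
    have := intervalIntegral.integral_eq_sub_of_hasDerivAt (a := 0) (b := t)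
      (f := fun s => -((1 - t) * (s * deriv φ s - φ s)))
      (f' := fun s => (s - t * s) * -(deriv (deriv φ) s))
      (fun s _ => ((((hasDerivAt_id s).mul (e2 s)).sub (e1 s)).const_mul (1 - t)).neg.congr_deriv
        (by simp; ring)) (Continuous.intervalIntegrable (by fun_prop) _ _)
    rw [← this]
    refine intervalIntegral.integral_congr fun s hs => ?_
    rw [Set.uIcc_of_le ht.1.le] at hs
    simp only [min_eq_right hs.2]
  have i2 : ∫ s in t..(1 : ℝ), (min t s - t * s) * -(deriv (deriv φ) s) =
      -(t * ((1 - 1) * deriv φ 1 + φ 1)) - -(t * ((1 - t) * deriv φ t + φ t)) := by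
    have := intervalIntegral.integral_eq_sub_of_hasDerivAt (a := t) (b := 1)
      (f := fun s => -(t * ((1 - s) * deriv φ s + φ s)))
      (f' := fun s => (t - t * s) * -(deriv (deriv φ) s))
      (fun s _ => (((((hasDerivAt_id s).const_sub 1).mul (e2 s)).add (e1 s)).const_mul t).neg.congr_deriv
        (by simp; ring)) (Continuous.intervalIntegrable (by fun_prop) _ _)
    rw [← this]
    refine intervalIntegral.integral_congr fun s hs => ?_
    rw [Set.uIcc_of_le ht.2.le] at hs
    simp only [min_eq_left hs.1]
  rw [i1, i2, h0, h1]
  ring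

/-- Test functions lie in the range of the covariance operator of the Brownian bridge. -/
theorem exists_covarianceBilin_eq_inner {R : L01} (hR : R ∈ testFunctions01) :
    ∃ η : L01, ∀ ξ : L01, covarianceBilin brownianBridgeLaw ξ η = ⟪ξ, R⟫ := by
  obtain ⟨φ, hφ, hs, hae⟩ := hR
  have hd1 : ContDiff ℝ (⊤ : ℕ∞) (deriv φ) := (contDiff_infty_iff_deriv.1 hφ).2
  have hd2 : Continuous (deriv (deriv φ)) := ((contDiff_infty_iff_deriv.1 hd1).2).continuous
  have hm := memLp_vol01_of_continuous (φ := fun s => -deriv (deriv φ) s) hd2.neg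
  refine ⟨hm.toLp, fun ξ => ?_⟩
  rw [covarianceBilin_comm, isBrownianBridgeLaw_brownianBridgeLaw.covariance_eq, L2.inner_def]
  have h0 : φ 0 = 0 := image_eq_zero_of_notMem_tsupport fun h => by simpa using (hs h).1
  have h1 : φ 1 = 0 := image_eq_zero_of_notMem_tsupport fun h => by simpa using (hs h).2
  refine integral_congr_ae ?_
  filter_upwards [hae, ae_restrict_mem measurableSet_Ioo] with t ht hmem
  rw [ht]
  have : ∫ s, (min t s - t * s) * (hm.toLp : L01) s ∂vol01 = φ t := by
    rw [← integral_bridgeKernel_mul_deriv_deriv hφ h0 h1 hmem]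
    refine integral_congr_ae ?_
    filter_upwards [hm.coeFn_toLp] with s hs
    rw [hs]
  rw [this]
  simp

/-! ### The gradient on trigonometric functions as a linear subspace. -/

theorem hasGradientAt_cos_inner_add (ξ f : L01) (α : ℝ) :
    HasGradientAt (fun f => Real.cos (⟪ξ, f⟫ + α)) (-Real.sin (⟪ξ, f⟫ + α) • ξ) f := by
  rw [hasGradientAt_iff_hasFDerivAt]
  have h := (((innerSL ℝ ξ).hasFDerivAt (x := f)).add_const α).cos
  refine h.congr_fderiv ?_
  ext y
  simp

theorem memLp_cos_inner_add (ξ : L01) (α : ℝ) :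
    MemLp (fun f => Real.cos (⟪ξ, f⟫ + α)) 2 brownianBridgeLaw :=
  MemLp.of_bound (by fun_prop) 1 (ae_of_all _ fun x => by simpa using Real.abs_cos_le_one _)

theorem memLp_neg_sin_inner_add_smul (ξ : L01) (α : ℝ) :
    MemLp (fun f => -Real.sin (⟪ξ, f⟫ + α) • ξ) 2 brownianBridgeLaw :=
  MemLp.of_bound (by fun_prop) ‖ξ‖ (ae_of_all _ fun x => by
    rw [norm_smul, norm_neg]
    exact mul_le_of_le_one_left (norm_nonneg _) (by simpa using Real.abs_sin_le_one _))

/-- The function `cos ((ξ, ·) + α)` together with its gradient. -/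
noncomputable def cosPair (ξ : L01) (α : ℝ) :
    Lp ℝ 2 brownianBridgeLaw × Lp L01 2 brownianBridgeLaw :=
  ((memLp_cos_inner_add ξ α).toLp, (memLp_neg_sin_inner_add_smul ξ α).toLp)

/-- The graph of the gradient on trigonometric functions with frequencies in `S`. -/
noncomputable def trigGraph (S : Set L01) :
    Submodule ℝ (Lp ℝ 2 brownianBridgeLaw × Lp L01 2 brownianBridgeLaw) :=
  Submodule.span ℝ {p | ∃ ξ ∈ S, ∃ α, p = cosPair ξ α}

theorem cosPair_mem_trigGraph {S : Set L01} {ξ : L01} (hξ : ξ ∈ S) (α : ℝ) :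
    cosPair ξ α ∈ trigGraph S := Submodule.subset_span ⟨ξ, hξ, α, rfl⟩

theorem cos_inner_add_mem_trigSpan {S : Set L01} {ξ : L01} (hξ : ξ ∈ S) (α : ℝ) :
    (fun f => Real.cos (⟪ξ, f⟫ + α)) ∈ trigSpan S := by
  have h1 : (fun f : L01 => Real.sin ⟪ξ, f⟫) ∈ trigSpan S :=
    Submodule.subset_span (Or.inl ⟨ξ, hξ, rfl⟩)
  have h2 : (fun f : L01 => Real.cos ⟪ξ, f⟫) ∈ trigSpan S :=
    Submodule.subset_span (Or.inr ⟨ξ, hξ, rfl⟩)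
  have := (trigSpan S).sub_mem ((trigSpan S).smul_mem (Real.cos α) h2)
    ((trigSpan S).smul_mem (Real.sin α) h1)
  convert this using 1
  ext f
  simp [Real.cos_add]
  ring

/-- Differentiability is carried through the induction because the gradient is additive only on
differentiable functions. -/
theorem exists_mem_trigGraph {S : Set L01} {F : L01 → ℝ} (hF : F ∈ trigSpan S) :
    Differentiable ℝ F ∧ ∃ p ∈ trigGraph S, p.1 =ᵐ[brownianBridgeLaw] F ∧
      p.2 =ᵐ[brownianBridgeLaw] ∇ F := by
  have hgen : ∀ ξ ∈ S, ∀ α : ℝ, Differentiable ℝ (fun f : L01 => Real.cos (⟪ξ, f⟫ + α)) ∧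
      ∃ p ∈ trigGraph S, p.1 =ᵐ[brownianBridgeLaw] (fun f : L01 => Real.cos (⟪ξ, f⟫ + α)) ∧
      p.2 =ᵐ[brownianBridgeLaw] ∇ (fun f : L01 => Real.cos (⟪ξ, f⟫ + α)) := fun ξ hξ α => by
    refine ⟨fun f => (hasGradientAt_cos_inner_add ξ f α).differentiableAt, cosPair ξ α,
      cosPair_mem_trigGraph hξ α, (memLp_cos_inner_add ξ α).coeFn_toLp, ?_⟩
    rw [gradient_eq fun f => hasGradientAt_cos_inner_add ξ f α]
    exact (memLp_neg_sin_inner_add_smul ξ α).coeFn_toLp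
  induction hF using Submodule.span_induction with
  | mem F hF =>
    rcases hF with ⟨ξ, hξ, rfl⟩ | ⟨ξ, hξ, rfl⟩
    · simpa only [← sub_eq_add_neg, Real.cos_sub_pi_div_two] using hgen ξ hξ (-(Real.pi / 2))
    · simpa using hgen ξ hξ 0
  | zero =>
    refine ⟨differentiable_const 0, 0, Submodule.zero_mem _, Lp.coeFn_zero _ _ _, ?_⟩
    rw [gradient_eq (f' := 0) fun f => hasGradientAt_const f 0]
    exact Lp.coeFn_zero _ _ _
  | add F G _ _ hF hG =>
    obtain ⟨dF, p, hp, hp1, hp2⟩ := hF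
    obtain ⟨dG, q, hq, hq1, hq2⟩ := hG
    refine ⟨dF.add dG, p + q, Submodule.add_mem _ hp hq,
      (Lp.coeFn_add _ _).trans (hp1.add hq1), (Lp.coeFn_add _ _).trans ((hp2.add hq2).trans ?_)⟩
    refine ae_of_all _ fun f => ?_
    simp only [Pi.add_apply, gradient, fderiv_add (dF f) (dG f), map_add]
  | smul c F _ hF =>
    obtain ⟨dF, p, hp, hp1, hp2⟩ := hF
    refine ⟨dF.const_smul c, c • p, Submodule.smul_mem _ c hp,
      (Lp.coeFn_smul _ _).trans (hp1.const_smul c),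
      (Lp.coeFn_smul _ _).trans ((hp2.const_smul c).trans ?_)⟩
    refine ae_of_all _ fun f => ?_
    simp only [Pi.smul_apply, gradient, fderiv_const_smul (dF f), map_smul]

/-- With this, the closure defining weak gradients is that of a subspace with explicit generators
`cosPair ξ α`, so closed linear conditions need checking only on single waves. -/
theorem mem_trigGraph_iff {S : Set L01}
    {p : Lp ℝ 2 brownianBridgeLaw × Lp L01 2 brownianBridgeLaw} :
    p ∈ trigGraph S ↔ ∃ F ∈ trigSpan S, p.1 =ᵐ[brownianBridgeLaw] F ∧
      p.2 =ᵐ[brownianBridgeLaw] ∇ F := by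
  constructor
  · intro hp
    induction hp using Submodule.span_induction with
    | mem p hp =>
      obtain ⟨ξ, hξ, α, rfl⟩ := hp
      refine ⟨_, cos_inner_add_mem_trigSpan hξ α, (memLp_cos_inner_add ξ α).coeFn_toLp, ?_⟩
      rw [gradient_eq fun f => hasGradientAt_cos_inner_add ξ f α]
      exact (memLp_neg_sin_inner_add_smul ξ α).coeFn_toLp
    | zero =>
      refine ⟨0, Submodule.zero_mem _, Lp.coeFn_zero _ _ _, ?_⟩
      rw [gradient_eq (f := (0 : L01 → ℝ)) (f' := 0) fun f => hasGradientAt_const f 0]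
      exact Lp.coeFn_zero _ _ _
    | add p q _ _ hp hq =>
      obtain ⟨F, hF, hp1, hp2⟩ := hp
      obtain ⟨G, hG, hq1, hq2⟩ := hq
      refine ⟨F + G, Submodule.add_mem _ hF hG, (Lp.coeFn_add _ _).trans (hp1.add hq1),
        (Lp.coeFn_add _ _).trans ((hp2.add hq2).trans (ae_of_all _ fun f => ?_))⟩
      simp only [Pi.add_apply, gradient, fderiv_add ((exists_mem_trigGraph hF).1 f)
        ((exists_mem_trigGraph hG).1 f), map_add]
    | smul c p _ hp =>
      obtain ⟨F, hF, hp1, hp2⟩ := hp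
      refine ⟨c • F, Submodule.smul_mem _ c hF, (Lp.coeFn_smul _ _).trans (hp1.const_smul c),
        (Lp.coeFn_smul _ _).trans ((hp2.const_smul c).trans (ae_of_all _ fun f => ?_))⟩
      simp only [Pi.smul_apply, gradient, fderiv_const_smul ((exists_mem_trigGraph hF).1 f),
        map_smul]
  · rintro ⟨F, hF, h1, h2⟩
    obtain ⟨-, q, hq, hq1, hq2⟩ := exists_mem_trigGraph hF
    have : p = q := Prod.ext (Lp.ext (h1.trans hq1.symm)) (Lp.ext (h2.trans hq2.symm))
    rwa [this]

theorem hasWeakGradient_iff {u : Lp ℝ 2 brownianBridgeLaw} {v : Lp L01 2 brownianBridgeLaw} :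
    HasWeakGradient u v ↔ (u, v) ∈ (trigGraph Set.univ).topologicalClosure := by
  rw [HasWeakGradient, ← SetLike.mem_coe, Submodule.topologicalClosure_coe]
  have : {p : Lp ℝ 2 brownianBridgeLaw × Lp L01 2 brownianBridgeLaw |
    ∃ F ∈ expL, p.1 =ᵐ[brownianBridgeLaw] F ∧ p.2 =ᵐ[brownianBridgeLaw] ∇ F} =
      (trigGraph Set.univ : Set _) := by
    ext p
    exact mem_trigGraph_iff.symm
  rw [this]

theorem trigGraph_mono {S T : Set L01} (h : S ⊆ T) : trigGraph S ≤ trigGraph T :=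
  Submodule.span_mono fun _ ⟨ξ, hξ, α, hp⟩ => ⟨ξ, h hξ, α, hp⟩

/-! ### Uniqueness of the weak gradient. -/

/-- Gaussian integration by parts, extended to the closure of the gradient. -/
theorem HasWeakGradient.integral_by_parts {u : Lp ℝ 2 brownianBridgeLaw}
    {v : Lp L01 2 brownianBridgeLaw} (huv : HasWeakGradient u v) {R η : L01}
    (hR : ∀ ξ : L01, covarianceBilin brownianBridgeLaw ξ η = ⟪ξ, R⟫) (ζ : L01) (β : ℝ) :
    ∫ f, u f * (⟪η, f⟫ * Real.cos (⟪ζ, f⟫ + β) + ⟪ζ, R⟫ * Real.sin (⟪ζ, f⟫ + β))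
      ∂brownianBridgeLaw =
    ∫ f, ⟪v f, R⟫ * Real.cos (⟪ζ, f⟫ + β) ∂brownianBridgeLaw := by
  have hH : MemLp (fun f => ⟪η, f⟫ * Real.cos (⟪ζ, f⟫ + β) + ⟪ζ, R⟫ * Real.sin (⟪ζ, f⟫ + β)) 2
      brownianBridgeLaw := by
    refine MemLp.add ?_ (MemLp.of_bound (by fun_prop) |⟪ζ, R⟫| (ae_of_all _ fun x => ?_))
    · refine (memLp_inner_of_isGaussian brownianBridgeLaw η).mono (by fun_prop)
        (ae_of_all _ fun x => ?_)
      rw [norm_mul]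
      exact mul_le_of_le_one_right (norm_nonneg _) (by simpa using Real.abs_cos_le_one _)
    · rw [norm_mul]
      exact mul_le_of_le_one_right (norm_nonneg _) (by simpa using Real.abs_sin_le_one _)
  have hG : MemLp (fun f => Real.cos (⟪ζ, f⟫ + β) • R) 2 brownianBridgeLaw :=
    MemLp.of_bound (by fun_prop) ‖R‖ (ae_of_all _ fun x => by
      rw [norm_smul]
      exact mul_le_of_le_one_left (norm_nonneg _) (by simpa using Real.abs_cos_le_one _))
  have eH : ∀ u : Lp ℝ 2 brownianBridgeLaw, ⟪hH.toLp, u⟫ = ∫ f, u f *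
      (⟪η, f⟫ * Real.cos (⟪ζ, f⟫ + β) + ⟪ζ, R⟫ * Real.sin (⟪ζ, f⟫ + β)) ∂brownianBridgeLaw :=
    fun u => by
      rw [L2.inner_def]
      refine integral_congr_ae ?_
      filter_upwards [hH.coeFn_toLp] with t ht
      rw [ht]
      simp
  have eG : ∀ v : Lp L01 2 brownianBridgeLaw, ⟪hG.toLp, v⟫ =
      ∫ f, ⟪v f, R⟫ * Real.cos (⟪ζ, f⟫ + β) ∂brownianBridgeLaw := fun v => by
      rw [L2.inner_def]
      refine integral_congr_ae ?_
      filter_upwards [hG.coeFn_toLp] with t ht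
      rw [ht, real_inner_smul_left, real_inner_comm R, mul_comm]
  rw [← eH, ← eG]
  -- The difference of the two sides is a continuous linear functional of `(u, v)`; its kernel is
  -- closed and contains the generators.
  let A : (Lp ℝ 2 brownianBridgeLaw × Lp L01 2 brownianBridgeLaw) →L[ℝ] ℝ :=
    (innerSL ℝ (hH.toLp)).comp (ContinuousLinearMap.fst ℝ _ _) -
      (innerSL ℝ (hG.toLp)).comp (ContinuousLinearMap.snd ℝ _ _)
  have hle : (trigGraph Set.univ).topologicalClosure ≤ A.ker := by
    refine Submodule.topologicalClosure_minimal _ ?_ A.isClosed_ker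
    refine Submodule.span_le.2 ?_
    rintro _ ⟨ξ, -, α, rfl⟩
    change ⟪hH.toLp, (cosPair ξ α).1⟫ - ⟪hG.toLp, (cosPair ξ α).2⟫ = 0
    rw [eH, eG, sub_eq_zero]
    have := integral_cos_mul_cos_by_parts brownianBridgeLaw
      isBrownianBridgeLaw_brownianBridgeLaw.mean_eq_zero ξ ζ η α β
    simp only [hR] at this
    refine Eq.trans ?_ (this.trans ?_)
    · refine integral_congr_ae ?_
      filter_upwards [(memLp_cos_inner_add ξ α).coeFn_toLp] with f hf
      simp only [cosPair, hf]
    · refine integral_congr_ae ?_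
      filter_upwards [(memLp_neg_sin_inner_add_smul ξ α).coeFn_toLp] with f hf
      simp only [cosPair, hf, real_inner_smul_left]
  exact sub_eq_zero.1 (hle (hasWeakGradient_iff.1 huv))

theorem integrable_inner_Lp (v : Lp L01 2 brownianBridgeLaw) (R : L01) :
    Integrable (fun f => ⟪v f, R⟫) brownianBridgeLaw := by
  have : MemLp (fun f => ⟪v f, R⟫) 2 brownianBridgeLaw := (Lp.memLp v).inner_const R
  exact this.integrable (by norm_num)

/-- For `R` in the range of the covariance operator, integration by parts expresses the moments of
`⟪v, R⟫` through `u` alone, so `⟪v - v', R⟫ = 0` almost everywhere. A countable dense set of such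
`R` makes the null set independent of `R`. -/
theorem HasWeakGradient.unique {u : Lp ℝ 2 brownianBridgeLaw} {v v' : Lp L01 2 brownianBridgeLaw}
    (h : HasWeakGradient u v) (h' : HasWeakGradient u v') : v = v' := by
  have key : ∀ R ∈ testFunctions01, ∀ᵐ f ∂brownianBridgeLaw, ⟪v f - v' f, R⟫ = 0 := by
    intro R hR
    obtain ⟨η, hη⟩ := exists_covarianceBilin_eq_inner hR
    have i1 := integrable_inner_Lp v R
    have i2 := integrable_inner_Lp v' R
    have := ae_eq_zero_of_integral_mul_cos_eq_zero brownianBridgeLaw (i1.sub i2) fun ζ β => by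
      have hb : ∀ w : L01 → ℝ, Integrable w brownianBridgeLaw →
          Integrable (fun f => w f * Real.cos (⟪ζ, f⟫ + β)) brownianBridgeLaw := fun w hw =>
        hw.mul_bdd (c := 1) (by fun_prop) (ae_of_all _ fun x => by
          simpa using Real.abs_cos_le_one _)
      simp only [Pi.sub_apply, sub_mul]
      rw [integral_sub (hb _ i1) (hb _ i2), ← h.integral_by_parts hη, ← h'.integral_by_parts hη,
        sub_self]
    filter_upwards [this] with f hf
    rw [inner_sub_left]
    exact hf
  refine Lp.ext ?_
  obtain ⟨D, hD, hDc, hDd⟩ := dense_testFunctions01.exists_countable_dense_subset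
  have hall : ∀ᵐ f ∂brownianBridgeLaw, ∀ R ∈ D, ⟪v f - v' f, R⟫ = 0 :=
    (ae_ball_iff hDc).2 fun R hR => key R (hD hR)
  filter_upwards [hall] with f hf
  rw [← sub_eq_zero]
  exact hDd.eq_zero_of_inner_left ℝ hf

/-! ### Dominated convergence in `L²` and density of `exp(C^∞)`. -/

section DominatedConvergence

variable {Ω E : Type*} [MeasurableSpace Ω] [NormedAddCommGroup E] [InnerProductSpace ℝ E]
  {μ : Measure Ω}

theorem norm_toLp_sub_toLp_sq {a b : Ω → E} (ha : MemLp a 2 μ) (hb : MemLp b 2 μ) :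
    ‖ha.toLp - hb.toLp‖ ^ 2 = ∫ ω, ‖a ω - b ω‖ ^ 2 ∂μ := by
  rw [← MemLp.toLp_sub, ← real_inner_self_eq_norm_sq, L2.inner_def]
  refine integral_congr_ae ?_
  filter_upwards [(ha.sub hb).coeFn_toLp] with ω h
  rw [h, real_inner_self_eq_norm_sq, Pi.sub_apply]

/-- Dominated convergence in `L²`. -/
theorem tendsto_toLp_of_dominated {U : ℕ → Ω → E} {u : Ω → E} (hU : ∀ n, MemLp (U n) 2 μ)
    (hu : MemLp u 2 μ) {b : Ω → ℝ} (hb : MemLp b 2 μ) (hbd : ∀ n, ∀ᵐ ω ∂μ, ‖U n ω‖ ≤ b ω)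
    (hlim : ∀ᵐ ω ∂μ, Tendsto (fun n => U n ω) atTop (𝓝 (u ω))) :
    Tendsto (fun n => (hU n).toLp) atTop (𝓝 hu.toLp) := by
  rw [tendsto_iff_norm_sub_tendsto_zero]
  have hsq : Tendsto (fun n => ‖(hU n).toLp - hu.toLp‖ ^ 2) atTop (𝓝 0) := by
    simp_rw [norm_toLp_sub_toLp_sq]
    have := tendsto_integral_of_dominated_convergence (μ := μ)
      (F := fun n ω => ‖U n ω - u ω‖ ^ 2) (f := fun _ => (0 : ℝ))
      (fun ω => (2 * b ω) ^ 2) (fun n => (((hU n).1.sub hu.1).norm.pow 2))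
      ((hb.const_mul 2).integrable_sq) ?_ ?_
    · simpa using this
    · intro n
      filter_upwards [ae_all_iff.2 hbd, hlim] with ω h1 h2
      have h3 : ‖u ω‖ ≤ b ω := le_of_tendsto h2.norm (Eventually.of_forall h1)
      rw [norm_pow, norm_norm]
      gcongr
      calc ‖U n ω - u ω‖ ≤ ‖U n ω‖ + ‖u ω‖ := norm_sub_le _ _
        _ ≤ 2 * b ω := by linarith [h1 n]
    · filter_upwards [hlim] with ω h
      have h2 := (tendsto_iff_norm_sub_tendsto_zero.1 h).pow 2
      simpa using h2
  have := hsq.sqrt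
  simpa [Real.sqrt_sq (norm_nonneg _)] using this

end DominatedConvergence

/-- The waves with frequencies `x n → ξ` converge pointwise with their gradients; the gradients are
dominated by a bound for the convergent sequence `‖x n‖`. -/
theorem cosPair_mem_topologicalClosure {S : Set L01} (hS : Dense S) (ξ : L01) (α : ℝ) :
    cosPair ξ α ∈ (trigGraph S).topologicalClosure := by
  obtain ⟨x, hxS, hx⟩ := mem_closure_iff_seq_limit.1 (hS ξ)
  obtain ⟨C, hC⟩ := hx.norm.bddAbove_range
  have hC' : ∀ n, ‖x n‖ ≤ C := fun n => hC ⟨n, rfl⟩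
  have hin : ∀ f : L01, Tendsto (fun n => ⟪x n, f⟫ + α) atTop (𝓝 (⟪ξ, f⟫ + α)) := fun f =>
    (hx.inner tendsto_const_nhds).add_const α
  refine mem_closure_of_tendsto (f := fun n => cosPair (x n) α) (b := atTop) ?_
    (Eventually.of_forall fun n => cosPair_mem_trigGraph (hxS n) α)
  refine Tendsto.prodMk_nhds ?_ ?_
  · refine tendsto_toLp_of_dominated _ _ (memLp_const (1 : ℝ)) (fun n => ae_of_all _ fun f => ?_)
      (ae_of_all _ fun f => (Real.continuous_cos.tendsto _).comp (hin f))
    simpa using Real.abs_cos_le_one _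
  · refine tendsto_toLp_of_dominated _ _ (memLp_const C) (fun n => ae_of_all _ fun f => ?_)
      (ae_of_all _ fun f => (((Real.continuous_sin.tendsto _).comp (hin f)).neg.smul hx))
    rw [norm_smul, norm_neg]
    exact (mul_le_of_le_one_left (norm_nonneg _) (by simpa using Real.abs_sin_le_one _)).trans
      (hC' n)

theorem topologicalClosure_trigGraph_of_dense {S : Set L01} (hS : Dense S) :
    (trigGraph S).topologicalClosure = (trigGraph Set.univ).topologicalClosure := by
  refine le_antisymm (Submodule.topologicalClosure_mono (trigGraph_mono (Set.subset_univ S))) ?_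
  refine Submodule.topologicalClosure_minimal _ ?_ (Submodule.isClosed_topologicalClosure _)
  refine Submodule.span_le.2 ?_
  rintro _ ⟨ξ, -, α, rfl⟩
  exact cosPair_mem_topologicalClosure hS ξ α

theorem dense_smooth01 : Dense smooth01 :=
  dense_testFunctions01.mono fun η h => by
    obtain ⟨φ, h1, _, h3⟩ := h
    exact ⟨φ, h1.contDiffOn, h3⟩

theorem HasWeakGradient.weakGradient_eq {u : Lp ℝ 2 brownianBridgeLaw}
    {v : Lp L01 2 brownianBridgeLaw} (h : HasWeakGradient u v) : weakGradient u = v := by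
  have hex : ∃ v, HasWeakGradient u v := ⟨v, h⟩
  rw [weakGradient, dif_pos hex]
  exact hex.choose_spec.unique h

theorem exists_mem_sobolevW12_of_mem_expSmooth {F : L01 → ℝ} (hF : F ∈ expSmooth) :
    ∃ w ∈ sobolevW12, w =ᵐ[brownianBridgeLaw] F := by
  obtain ⟨-, p, hp, h1, -⟩ := exists_mem_trigGraph hF
  exact ⟨p.1, ⟨p.2, hasWeakGradient_iff.2 (Submodule.le_topologicalClosure _
    (trigGraph_mono (Set.subset_univ _) hp))⟩, h1⟩

theorem exists_expSmooth_sobolevNorm_sub_lt {u : Lp ℝ 2 brownianBridgeLaw} (hu : u ∈ sobolevW12)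
    {ε : ℝ} (hε : 0 < ε) : ∃ F ∈ expSmooth, ∃ w ∈ sobolevW12,
      w =ᵐ[brownianBridgeLaw] F ∧ sobolevNorm (u - w) < ε := by
  obtain ⟨v, huv⟩ := hu
  have hmem := hasWeakGradient_iff.1 huv
  rw [← topologicalClosure_trigGraph_of_dense dense_smooth01] at hmem
  -- The product carries the maximum norm, so both components are below `ε / 2` and their squares
  -- add up to less than `ε ^ 2`.
  obtain ⟨p, hp, hd⟩ := Metric.mem_closure_iff.1 hmem (ε / 2) (by positivity)
  obtain ⟨F, hF, h1, -⟩ := mem_trigGraph_iff.1 hp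
  have hp' : p ∈ (trigGraph Set.univ).topologicalClosure :=
    Submodule.le_topologicalClosure _ (trigGraph_mono (Set.subset_univ _) hp)
  refine ⟨F, hF, p.1, ⟨p.2, hasWeakGradient_iff.2 hp'⟩, h1, ?_⟩
  have hsub : HasWeakGradient (u - p.1) (v - p.2) :=
    hasWeakGradient_iff.2 (Submodule.sub_mem _ (hasWeakGradient_iff.1 huv) hp')
  rw [sobolevNorm, hsub.weakGradient_eq]
  rw [dist_eq_norm, Prod.norm_def, max_lt_iff] at hd
  obtain ⟨d1, d2⟩ := hd
  rw [Real.sqrt_lt' hε]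
  simp only [Prod.fst_sub, Prod.snd_sub] at d1 d2
  nlinarith [norm_nonneg (u - p.1), norm_nonneg (v - p.2)]

/-! ### Smooth cylindrical functions by Fourier inversion and duality. -/

section FourierRepresentation

open scoped FourierTransform SchwartzMap LineDeriv

variable {V : Type*} [NormedAddCommGroup V] [InnerProductSpace ℝ V] [FiniteDimensional ℝ V]
  [MeasurableSpace V] [BorelSpace V]

/-- A smooth compactly supported function and its derivative as superpositions of plane waves. -/
theorem exists_schwartz_fourier_representation {G : V → ℝ} (hG : ContDiff ℝ (⊤ : ℕ∞) G)
    (hc : HasCompactSupport G) :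
    ∃ h : 𝓢(V, ℂ), (∀ x, (G x : ℂ) =
        ∫ w, Complex.exp ((2 * Real.pi * ⟪w, x⟫ : ℝ) * Complex.I) * h w) ∧
      ∀ x m, ((fderiv ℝ G x m : ℝ) : ℂ) =
        ∫ w, (2 * Real.pi * ⟪w, m⟫ : ℝ) * Complex.I *
          (Complex.exp ((2 * Real.pi * ⟪w, x⟫ : ℝ) * Complex.I) * h w) := by
  have hc' : HasCompactSupport (fun x => (G x : ℂ)) := hc.comp_left (g := fun r : ℝ => (r : ℂ)) (by simp)
  have hG' : ContDiff ℝ (⊤ : ℕ∞) (fun x => (G x : ℂ)) := Complex.ofRealCLM.contDiff.comp hG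
  let ψ : 𝓢(V, ℂ) := hc'.toSchwartzMap hG'
  have hψ : ∀ x, ψ x = (G x : ℂ) := fun x => rfl
  refine ⟨𝓕 ψ, fun x => ?_, fun x m => ?_⟩
  · rw [← hψ, ← FourierTransform.fourierInv_fourier_eq (F := 𝓢(V, ℂ)) ψ]
    rw [SchwartzMap.fourierInv_coe, Real.fourierInv_eq']
    simp [smul_eq_mul]
  · have h1 : ((fderiv ℝ G x m : ℝ) : ℂ) = (∂_{m} ψ) x := by
      rw [SchwartzMap.lineDerivOp_apply_eq_fderiv]
      have : HasFDerivAt ψ (Complex.ofRealCLM.comp (fderiv ℝ G x)) x :=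
        Complex.ofRealCLM.hasFDerivAt.comp x
          (hG.differentiable (by simp) x).hasFDerivAt
      rw [this.fderiv]
      simp
    have ht : (inner ℝ · m : V → ℝ).HasTemperateGrowth := ((innerSL ℝ).flip m).hasTemperateGrowth
    rw [h1, ← FourierTransform.fourierInv_fourier_eq (F := 𝓢(V, ℂ)) ψ,
      SchwartzMap.lineDerivOp_fourierInv_eq, SchwartzMap.fourierInv_coe, Real.fourierInv_eq']
    refine integral_congr_ae (ae_of_all _ fun w => ?_)
    simp [ht, smul_eq_mul]
    ring

end FourierRepresentation

/-- `V` represents the weak gradient of `U`. -/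
def IsWeakGradient (U : L01 → ℝ) (V : L01 → L01) : Prop :=
  ∃ (hU : MemLp U 2 brownianBridgeLaw) (hV : MemLp V 2 brownianBridgeLaw),
    HasWeakGradient hU.toLp hV.toLp

theorem IsWeakGradient.of_tendsto {U : ℕ → L01 → ℝ} {V : ℕ → L01 → L01} {u : L01 → ℝ}
    {v : L01 → L01} (h : ∀ n, IsWeakGradient (U n) (V n)) {C : ℝ} (hU : ∀ n f, ‖U n f‖ ≤ C)
    (hV : ∀ n f, ‖V n f‖ ≤ C) (hu : ∀ f, Tendsto (fun n => U n f) atTop (𝓝 (u f)))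
    (hv : ∀ f, Tendsto (fun n => V n f) atTop (𝓝 (v f))) : IsWeakGradient u v := by
  choose mU mV hw using h
  have mu : MemLp u 2 brownianBridgeLaw := MemLp.of_bound
    (aestronglyMeasurable_of_tendsto_ae atTop (fun n => (mU n).1) (ae_of_all _ hu)) C
    (ae_of_all _ fun f => le_of_tendsto (hu f).norm (Eventually.of_forall fun n => hU n f))
  have mv : MemLp v 2 brownianBridgeLaw := MemLp.of_bound
    (aestronglyMeasurable_of_tendsto_ae atTop (fun n => (mV n).1) (ae_of_all _ hv)) C
    (ae_of_all _ fun f => le_of_tendsto (hv f).norm (Eventually.of_forall fun n => hV n f))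
  refine ⟨mu, mv, ?_⟩
  rw [hasWeakGradient_iff]
  refine (Submodule.isClosed_topologicalClosure _).mem_of_tendsto
    (f := fun n => ((mU n).toLp, (mV n).toLp)) (b := atTop) ?_
    (Eventually.of_forall fun n => hasWeakGradient_iff.1 (hw n))
  exact Tendsto.prodMk_nhds
    (tendsto_toLp_of_dominated mU mu (memLp_const C) (fun n => ae_of_all _ (hU n))
      (ae_of_all _ hu))
    (tendsto_toLp_of_dominated mV mv (memLp_const C) (fun n => ae_of_all _ (hV n))
      (ae_of_all _ hv))

/-- Duality criterion for weak gradients. -/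
theorem isWeakGradient_of_forall_integral_eq_zero {U : L01 → ℝ} {V : L01 → L01}
    (hU : MemLp U 2 brownianBridgeLaw) (hV : MemLp V 2 brownianBridgeLaw)
    (h : ∀ (a : Lp ℝ 2 brownianBridgeLaw) (b : Lp L01 2 brownianBridgeLaw),
      (∀ (ξ : L01) (α : ℝ), ∫ f, (a f * Real.cos (⟪ξ, f⟫ + α) - ⟪b f, ξ⟫ * Real.sin (⟪ξ, f⟫ + α))
        ∂brownianBridgeLaw = 0) →
      ∫ f, (a f * U f + ⟪b f, V f⟫) ∂brownianBridgeLaw = 0) : IsWeakGradient U V := by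
  refine ⟨hU, hV, hasWeakGradient_iff.2 ?_⟩
  by_contra hn
  set K := (trigGraph Set.univ).topologicalClosure
  obtain ⟨ℓ, r, h1, h2⟩ := geometric_hahn_banach_closed_point
    (E := Lp ℝ 2 brownianBridgeLaw × Lp L01 2 brownianBridgeLaw)
    (s := (K : Set (Lp ℝ 2 brownianBridgeLaw × Lp L01 2 brownianBridgeLaw)))
    K.convex (Submodule.isClosed_topologicalClosure _) hn
  -- A functional bounded above by `r` on a subspace vanishes there, since a multiple of `q` would
  -- otherwise attain the value `r + 1`. At the excluded point it exceeds `r > 0`, which contradicts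
  -- the duality hypothesis.
  have h0 : ∀ q ∈ K, ℓ q = 0 := fun q hq => by
    by_contra hq0
    have := h1 (((r + 1) / ℓ q) • q) (K.smul_mem _ hq)
    rw [map_smul, smul_eq_mul, div_mul_cancel₀ _ hq0] at this
    linarith
  have hr : 0 < r := by simpa using h1 0 K.zero_mem
  let a : Lp ℝ 2 brownianBridgeLaw :=
    (InnerProductSpace.toDual ℝ _).symm (ℓ.comp (ContinuousLinearMap.inl ℝ _ _))
  let b : Lp L01 2 brownianBridgeLaw :=
    (InnerProductSpace.toDual ℝ _).symm (ℓ.comp (ContinuousLinearMap.inr ℝ _ _))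
  have hℓ : ∀ {U' : L01 → ℝ} {V' : L01 → L01} (hU : MemLp U' 2 brownianBridgeLaw)
      (hV : MemLp V' 2 brownianBridgeLaw), ℓ (hU.toLp, hV.toLp) =
      ∫ f, (a f * U' f + ⟪b f, V' f⟫) ∂brownianBridgeLaw := by
    intro U' V' hU hV
    have e : ℓ (hU.toLp, hV.toLp) = ⟪a, hU.toLp⟫ + ⟪b, hV.toLp⟫ := by
      simp only [a, b, InnerProductSpace.toDual_symm_apply]
      rw [ContinuousLinearMap.comp_apply, ContinuousLinearMap.comp_apply, ← map_add]
      simp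
    rw [e, L2.inner_def, L2.inner_def, ← integral_add (L2.integrable_inner _ _)
      (L2.integrable_inner _ _)]
    refine integral_congr_ae ?_
    filter_upwards [hU.coeFn_toLp, hV.coeFn_toLp] with f k1 k2
    rw [k1, k2]
    simp [mul_comm]
  have hp := hℓ hU hV
  rw [h a b fun ξ α => ?_] at hp
  · linarith
  · have : ℓ (cosPair ξ α) = _ :=
      hℓ (memLp_cos_inner_add ξ α) (memLp_neg_sin_inner_add_smul ξ α)
    rw [h0 _ (Submodule.le_topologicalClosure _ (cosPair_mem_trigGraph (Set.mem_univ ξ) α))] at this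
    rw [this]
    refine integral_congr_ae (ae_of_all _ fun f => ?_)
    simp only [real_inner_smul_right]
    ring

theorem norm_gradient_eq {E : Type*} [NormedAddCommGroup E] [InnerProductSpace ℝ E]
    [CompleteSpace E] (F : E → ℝ) (x : E) : ‖∇ F x‖ = ‖fderiv ℝ F x‖ :=
  LinearIsometryEquiv.norm_map _ _

theorem inner_gradient_right_real {E : Type*} [NormedAddCommGroup E] [InnerProductSpace ℝ E]
    [CompleteSpace E] (F : E → ℝ) (x y : E) : ⟪y, ∇ F x⟫ = fderiv ℝ F x y := by
  rw [real_inner_comm, inner_gradient_left]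

theorem continuous_gradient {E : Type*} [NormedAddCommGroup E] [InnerProductSpace ℝ E]
    [CompleteSpace E] {F : E → ℝ} (hF : ContDiff ℝ (⊤ : ℕ∞) F) : Continuous (∇ F) :=
  (LinearIsometryEquiv.continuous _).comp (hF.continuous_fderiv (by simp))

section Cylindrical

variable {V : Type*} [NormedAddCommGroup V] [InnerProductSpace ℝ V] [FiniteDimensional ℝ V]
  [MeasurableSpace V] [BorelSpace V]

/-- The trigonometric moments of an annihilator of the gradient graph, in complex form. -/
theorem integral_mul_exp_eq_zero (a : Lp ℝ 2 brownianBridgeLaw) (b : Lp L01 2 brownianBridgeLaw)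
    (hab : ∀ (ξ : L01) (α : ℝ), ∫ f, (a f * Real.cos (⟪ξ, f⟫ + α) -
      ⟪b f, ξ⟫ * Real.sin (⟪ξ, f⟫ + α)) ∂brownianBridgeLaw = 0) (ξ : L01) :
    ∫ f, ((a f : ℂ) + (⟪b f, ξ⟫ : ℝ) * Complex.I) * Complex.exp ((⟪ξ, f⟫ : ℝ) * Complex.I)
      ∂brownianBridgeLaw = 0 := by
  have e : ∀ f, ((a f : ℂ) + (⟪b f, ξ⟫ : ℝ) * Complex.I) * Complex.exp ((⟪ξ, f⟫ : ℝ) * Complex.I)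
      = ((a f * Real.cos (⟪ξ, f⟫ + 0) - ⟪b f, ξ⟫ * Real.sin (⟪ξ, f⟫ + 0) : ℝ) : ℂ) +
        ((a f * Real.cos (⟪ξ, f⟫ + -(Real.pi / 2)) -
          ⟪b f, ξ⟫ * Real.sin (⟪ξ, f⟫ + -(Real.pi / 2)) : ℝ) : ℂ) * Complex.I := fun f => by
    rw [← sub_eq_add_neg, Real.cos_sub_pi_div_two, Real.sin_sub_pi_div_two, Complex.exp_mul_I,
      add_zero]
    push_cast
    linear_combination ((⟪b f, ξ⟫ : ℝ) : ℂ) * Complex.sin (⟪ξ, f⟫ : ℝ) * Complex.I_sq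
  have ia : Integrable a brownianBridgeLaw := (Lp.memLp a).integrable (by norm_num)
  have hi : ∀ α : ℝ, Integrable (fun f => a f * Real.cos (⟪ξ, f⟫ + α) -
      ⟪b f, ξ⟫ * Real.sin (⟪ξ, f⟫ + α)) brownianBridgeLaw := fun α =>
    (ia.mul_bdd (c := 1) (by fun_prop) (ae_of_all _ fun x => by
      simpa using Real.abs_cos_le_one _)).sub
    ((integrable_inner_Lp b ξ).mul_bdd (c := 1) (by fun_prop) (ae_of_all _ fun x => by
      simpa using Real.abs_sin_le_one _))
  simp_rw [e]
  rw [integral_add (hi 0).ofReal ((hi _).ofReal.mul_const _), integral_mul_const,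
    integral_complex_ofReal, integral_complex_ofReal, hab, hab]
  simp

/-- By Fourier inversion `G ∘ A` is a superposition of plane waves with frequencies `2π A* w`. An
annihilator `(a, b)` of the gradient graph kills each wave, hence by Fubini the superposition. -/
theorem isWeakGradient_of_hasCompactSupport (A : L01 →L[ℝ] V) {G : V → ℝ}
    (hG : ContDiff ℝ (⊤ : ℕ∞) G) (hc : HasCompactSupport G) :
    IsWeakGradient (fun f => G (A f)) (∇ fun f => G (A f)) := by
  have hGA : ContDiff ℝ (⊤ : ℕ∞) (fun f => G (A f)) := hG.comp A.contDiff
  have hfd : ∀ f, fderiv ℝ (fun f => G (A f)) f = (fderiv ℝ G (A f)).comp A := fun f => by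
    have := ((hG.differentiable (by simp) (A f)).hasFDerivAt.comp f A.hasFDerivAt)
    exact this.fderiv
  obtain ⟨C₁, hC₁⟩ := hc.exists_bound_of_continuous hG.continuous
  obtain ⟨C₂, hC₂⟩ := (hc.fderiv ℝ).exists_bound_of_continuous (hG.continuous_fderiv (by simp))
  refine isWeakGradient_of_forall_integral_eq_zero
    (MemLp.of_bound hGA.continuous.aestronglyMeasurable C₁ (ae_of_all _ fun f => hC₁ _))
    (MemLp.of_bound (continuous_gradient hGA).aestronglyMeasurable (C₂ * ‖A‖)
      (ae_of_all _ fun f => ?_)) ?_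
  · rw [norm_gradient_eq, hfd]
    exact (ContinuousLinearMap.opNorm_comp_le _ _).trans
      (mul_le_mul_of_nonneg_right (hC₂ _) (norm_nonneg _))
  intro a b hab
  simp only [inner_gradient_right_real, hfd, ContinuousLinearMap.comp_apply]
  obtain ⟨h, hh1, hh2⟩ := exists_schwartz_fourier_representation hG hc
  have ia : Integrable a brownianBridgeLaw := (Lp.memLp a).integrable (by norm_num)
  have ib : Integrable b brownianBridgeLaw := (Lp.memLp b).integrable (by norm_num)
  have hexp : ∀ (w : V) (f : L01),
      ‖Complex.exp ((2 * Real.pi * ⟪w, A f⟫ : ℝ) * Complex.I)‖ = 1 := fun w f =>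
    Complex.norm_exp_ofReal_mul_I _
  let Φ₁ : L01 × V → ℂ := fun p => (a p.1 : ℂ) *
    (Complex.exp ((2 * Real.pi * ⟪p.2, A p.1⟫ : ℝ) * Complex.I) * h p.2)
  let Φ₂ : L01 × V → ℂ := fun p => (2 * Real.pi * ⟪p.2, A (b p.1)⟫ : ℝ) * Complex.I *
    (Complex.exp ((2 * Real.pi * ⟪p.2, A p.1⟫ : ℝ) * Complex.I) * h p.2)
  have hcont : Continuous fun p : L01 × V =>
      Complex.exp ((2 * Real.pi * ⟪p.2, A p.1⟫ : ℝ) * Complex.I) * h p.2 := by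
    have := h.continuous
    fun_prop
  have m1 : AEStronglyMeasurable Φ₁ (brownianBridgeLaw.prod volume) :=
    (Complex.continuous_ofReal.comp_aestronglyMeasurable (Lp.aestronglyMeasurable a).comp_fst).mul
      hcont.aestronglyMeasurable
  have m2 : AEStronglyMeasurable Φ₂ (brownianBridgeLaw.prod volume) := by
    have h3 : AEStronglyMeasurable (fun p : L01 × V => A (b p.1)) (brownianBridgeLaw.prod volume) :=
      A.continuous.comp_aestronglyMeasurable (Lp.aestronglyMeasurable b).comp_fst
    have h4 : AEStronglyMeasurable (fun p : L01 × V => ⟪p.2, A (b p.1)⟫)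
        (brownianBridgeLaw.prod volume) :=
      (continuous_snd.aestronglyMeasurable).inner h3
    exact ((Complex.continuous_ofReal.comp_aestronglyMeasurable (h4.const_mul _)).mul_const _).mul
      hcont.aestronglyMeasurable
  have i1 : Integrable Φ₁ (brownianBridgeLaw.prod volume) := by
    refine (ia.norm.mul_prod (h.integrable (μ := volume)).norm).mono m1 (ae_of_all _ fun p => ?_)
    simp only [Φ₁, norm_mul, hexp, one_mul, norm_norm, Complex.norm_real]
    exact le_rfl
  -- Differentiation brings down a factor of size `‖w‖`, absorbed by the decay of the Schwartz
  -- function `h`.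
  have i2 : Integrable Φ₂ (brownianBridgeLaw.prod volume) := by
    refine ((ib.norm.const_mul (2 * Real.pi * ‖A‖)).mul_prod
      (h.integrable_pow_mul volume 1)).mono m2 (ae_of_all _ fun p => ?_)
    simp only [Φ₂, norm_mul, hexp, one_mul, Complex.norm_real, pow_one, Complex.norm_I,
      mul_one, Real.norm_eq_abs, abs_two, abs_of_pos Real.pi_pos]
    have k1 := abs_real_inner_le_norm p.2 (A (b p.1))
    have k2 := A.le_opNorm (b p.1)
    have k3 : |⟪p.2, A (b p.1)⟫| ≤ ‖p.2‖ * (‖A‖ * ‖b p.1‖) :=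
      k1.trans (mul_le_mul_of_nonneg_left k2 (norm_nonneg _))
    calc 2 * Real.pi * |⟪p.2, A (b p.1)⟫| * ‖h p.2‖
        ≤ 2 * Real.pi * (‖p.2‖ * (‖A‖ * ‖b p.1‖)) * ‖h p.2‖ := by
          gcongr
      _ = _ := by simp only [abs_norm]; ring
  have hre : ((∫ f, (a f * G (A f) + fderiv ℝ G (A f) (A (b f))) ∂brownianBridgeLaw : ℝ) : ℂ) =
      ∫ f, ∫ w, (Φ₁ (f, w) + Φ₂ (f, w)) ∂volume ∂brownianBridgeLaw := by
    rw [← integral_complex_ofReal]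
    refine integral_congr_ae ?_
    filter_upwards [i1.prod_right_ae, i2.prod_right_ae] with f k1 k2
    rw [integral_add k1 k2]
    push_cast
    rw [hh1, hh2, ← integral_const_mul]
  have hz : ∫ f, ∫ w, (Φ₁ (f, w) + Φ₂ (f, w)) ∂volume ∂brownianBridgeLaw = 0 := by
    rw [integral_integral_swap (f := fun f w => Φ₁ (f, w) + Φ₂ (f, w)) (i1.add i2)]
    refine integral_eq_zero_of_ae (ae_of_all _ fun w => ?_)
    have hadj : ∀ f, ⟪(2 * Real.pi) • A.adjoint w, f⟫ = 2 * Real.pi * ⟪w, A f⟫ := fun f => by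
      rw [real_inner_smul_left, ContinuousLinearMap.adjoint_inner_left]
    have h0 := integral_mul_exp_eq_zero a b hab ((2 * Real.pi) • A.adjoint w)
    have := congrArg (· * h w) h0
    simp only [zero_mul] at this
    rw [← integral_mul_const] at this
    rw [Pi.zero_apply, ← this]
    refine integral_congr_ae (ae_of_all _ fun f => ?_)
    simp only [Φ₁, Φ₂, hadj, real_inner_comm ((2 * Real.pi) • A.adjoint w) (b f)]
    ring
  rw [hz] at hre
  exact_mod_cast hre

/-- Smooth cylindrical functions that are bounded with bounded gradient have a weak gradient. -/
theorem isWeakGradient_of_bounded (A : L01 →L[ℝ] V) {G : V → ℝ}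
    (hG : ContDiff ℝ (⊤ : ℕ∞) G) {C : ℝ} (hC : ∀ f, ‖G (A f)‖ ≤ C)
    (hC' : ∀ f, ‖∇ (fun f => G (A f)) f‖ ≤ C) :
    IsWeakGradient (fun f => G (A f)) (∇ fun f => G (A f)) := by
  let χ : ContDiffBump (0 : V) := ⟨1, 2, one_pos, one_lt_two⟩
  have hχs : ContDiff ℝ (⊤ : ℕ∞) χ := χ.contDiff
  obtain ⟨M, hM⟩ := (χ.hasCompactSupport.fderiv ℝ).exists_bound_of_continuous
    (hχs.continuous_fderiv (by simp))
  have hM0 : 0 ≤ M := (norm_nonneg _).trans (hM 0)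
  have hC0 : 0 ≤ C := (norm_nonneg _).trans (hC 0)
  let c : ℕ → ℝ := fun n => 1 / ((n : ℝ) + 1)
  have hc0 : ∀ n, 0 < c n := fun n => by positivity
  have hc1 : ∀ n, c n ≤ 1 := fun n => by
    rw [div_le_one (by positivity)]; linarith [Nat.cast_nonneg (α := ℝ) n]
  have hct : Tendsto c atTop (𝓝 0) := tendsto_one_div_add_atTop_nhds_zero_nat
  -- Dilated cutoffs: `χ (c n • A f)` tends to `1` for each `f`, while its gradient is at most `M *
  -- ‖A‖ * c n`, so the extra term of the product rule disappears in the limit.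
  let K : ℕ → V → ℝ := fun n x => χ (c n • x) * G x
  have hKs : ∀ n, ContDiff ℝ (⊤ : ℕ∞) (K n) := fun n =>
    (hχs.comp (contDiff_const_smul (c n))).mul hG
  have hKc : ∀ n, HasCompactSupport (K n) := fun n =>
    (χ.hasCompactSupport.comp_smul (hc0 n).ne').mul_right
  have hGA : ContDiff ℝ (⊤ : ℕ∞) (fun f => G (A f)) := hG.comp A.contDiff
  let B : ℕ → L01 → L01 := fun n f => ∇ (fun f => χ (c n • A f)) f
  have hχd : ∀ n f, HasFDerivAt (fun f => χ (c n • A f))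
      ((fderiv ℝ χ (c n • A f)).comp (c n • A)) f := fun n f => by
    have h1 : HasFDerivAt χ (fderiv ℝ χ (c n • A f)) (c n • A f) :=
      (hχs.differentiable (by simp) _).hasFDerivAt
    exact HasFDerivAt.comp (g := χ) (f := fun f => c n • A f) f h1 (c n • A).hasFDerivAt
  have hB : ∀ n f, ‖B n f‖ ≤ M * ‖A‖ * c n := fun n f => by
    simp only [B]
    rw [norm_gradient_eq, (hχd n f).fderiv]
    refine (ContinuousLinearMap.opNorm_comp_le _ _).trans ?_
    rw [norm_smul, Real.norm_of_nonneg (hc0 n).le]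
    calc ‖fderiv ℝ χ (c n • A f)‖ * (c n * ‖A‖) ≤ M * (c n * ‖A‖) := by
          have := hM (c n • A f)
          have := (hc0 n).le
          gcongr
      _ = _ := by ring
  have hgrad : ∀ n, (∇ fun f => K n (A f)) =
      fun f => χ (c n • A f) • ∇ (fun f => G (A f)) f + G (A f) • B n f := fun n => by
    refine gradient_eq fun f => ?_
    have h2 := (hGA.differentiable (by simp) f).hasFDerivAt
    have h3 := (hχd n f).mul h2
    rw [hasGradientAt_iff_hasFDerivAt]
    refine h3.congr_fderiv ?_
    simp only [B, gradient, (hχd n f).fderiv, map_add, map_smul, LinearIsometryEquiv.apply_symm_apply]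
  have hlim : ∀ f, Tendsto (fun n => χ (c n • A f)) atTop (𝓝 1) := fun f => by
    have h1 : χ (0 : V) = 1 := χ.one_of_mem_closedBall (by simp [χ.rIn_pos.le])
    have h2 : Tendsto (fun n => c n • A f) atTop (𝓝 0) := by
      simpa using hct.smul_const (A f)
    have := (hχs.continuous.tendsto 0).comp h2
    rwa [h1] at this
  have hχ1 : ∀ x, ‖χ x‖ ≤ 1 := fun x => by
    rw [Real.norm_of_nonneg χ.nonneg]; exact χ.le_one
  refine IsWeakGradient.of_tendsto (C := C + C * (M * ‖A‖))
    (fun n => isWeakGradient_of_hasCompactSupport A (hKs n) (hKc n)) (fun n f => ?_) (fun n f => ?_)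
    (fun f => ?_) (fun f => ?_)
  · rw [norm_mul]
    have : ‖χ (c n • A f)‖ * ‖G (A f)‖ ≤ 1 * C := by gcongr; exacts [hχ1 _, hC f]
    have : 0 ≤ C * (M * ‖A‖) := by positivity
    linarith
  · rw [hgrad]
    refine (norm_add_le _ _).trans ?_
    rw [norm_smul, norm_smul]
    have k1 : ‖χ (c n • A f)‖ * ‖∇ (fun f => G (A f)) f‖ ≤ 1 * C := by
      gcongr; exacts [hχ1 _, hC' f]
    have k2 : ‖G (A f)‖ * ‖B n f‖ ≤ C * (M * ‖A‖ * 1) := by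
      gcongr
      exacts [hC f, (hB n f).trans (by have := hc1 n; gcongr)]
    linarith
  · simpa using (hlim f).mul_const (G (A f))
  · simp only [hgrad]
    have hB0 : Tendsto (fun n => B n f) atTop (𝓝 0) := by
      refine squeeze_zero_norm (hB · f) ?_
      simpa using hct.const_mul (M * ‖A‖)
    simpa using ((hlim f).smul_const (∇ (fun f => G (A f)) f)).add (hB0.const_smul (G (A f)))

end Cylindrical

/-! ### Approximation by step functions. -/

/-- The `j`-th of the `n + 1` intervals of equal length in `[0, 1)`. -/
def cell (n : ℕ) (j : Fin (n + 1)) : Set ℝ := Set.Ico ((j : ℝ) / (n + 1)) (((j : ℝ) + 1) / (n + 1))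

theorem measurableSet_cell (n : ℕ) (j : Fin (n + 1)) : MeasurableSet (cell n j) :=
  measurableSet_Ico

theorem vol01_cell (n : ℕ) (j : Fin (n + 1)) : vol01 (cell n j) = ENNReal.ofReal (1 / (n + 1)) := by
  have hn : (0 : ℝ) < n + 1 := by positivity
  have hj : (j : ℝ) + 1 ≤ n + 1 := by exact_mod_cast j.2
  have hlen : ((j : ℝ) + 1) / (n + 1) - (j : ℝ) / (n + 1) = 1 / (n + 1) := by ring
  rw [vol01, Measure.restrict_apply (measurableSet_cell n j)]
  apply le_antisymm
  · refine (measure_mono Set.inter_subset_left).trans ?_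
    rw [cell, Real.volume_Ico, hlen]
  · have hsub : Set.Ioo ((j : ℝ) / (n + 1)) (((j : ℝ) + 1) / (n + 1)) ⊆
        cell n j ∩ Set.Ioo 0 1 := fun t ht =>
      ⟨⟨ht.1.le, ht.2⟩, lt_of_le_of_lt (by positivity) ht.1,
        ht.2.trans_le ((div_le_one hn).2 hj)⟩
    refine le_trans ?_ (measure_mono hsub)
    rw [Real.volume_Ioo, hlen]

theorem exists_mem_cell (n : ℕ) {t : ℝ} (ht : t ∈ Set.Ioo (0 : ℝ) 1) : ∃ j, t ∈ cell n j := by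
  have hn : (0 : ℝ) < n + 1 := by positivity
  have h0 : 0 ≤ t * (n + 1) := mul_nonneg ht.1.le hn.le
  have hlt : ⌊t * (n + 1)⌋₊ < n + 1 := by
    rw [Nat.floor_lt h0]
    push_cast
    nlinarith [ht.2]
  refine ⟨⟨_, hlt⟩, ?_, ?_⟩
  · rw [div_le_iff₀ hn]
    exact Nat.floor_le h0
  · rw [lt_div_iff₀ hn]
    exact Nat.lt_floor_add_one _

theorem eq_of_mem_cell {n : ℕ} {j k : Fin (n + 1)} {t : ℝ} (hj : t ∈ cell n j)
    (hk : t ∈ cell n k) : j = k := by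
  have hn : (0 : ℝ) < n + 1 := by positivity
  have h1 : (j : ℝ) < k + 1 := (div_lt_div_iff_of_pos_right hn).1 (hj.1.trans_lt hk.2)
  have h2 : (k : ℝ) < j + 1 := (div_lt_div_iff_of_pos_right hn).1 (hk.1.trans_lt hj.2)
  have h1' : (j : ℕ) < k + 1 := by exact_mod_cast h1
  have h2' : (k : ℕ) < j + 1 := by exact_mod_cast h2
  exact Fin.ext (by omega)

theorem abs_sub_le_of_mem_cell {n : ℕ} {j : Fin (n + 1)} {s t : ℝ} (hs : s ∈ cell n j)
    (ht : t ∈ cell n j) : |s - t| ≤ 1 / (n + 1) := by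
  have hlen : ((j : ℝ) + 1) / (n + 1) - (j : ℝ) / (n + 1) = 1 / (n + 1) := by ring
  rw [abs_le]
  constructor <;> linarith [hs.1, hs.2, ht.1, ht.2]

/-- The normalized indicator of a cell. -/
noncomputable def stepVec (n : ℕ) (j : Fin (n + 1)) : L01 :=
  indicatorConstLp 2 (measurableSet_cell n j) (measure_ne_top _ _) √((n : ℝ) + 1)

theorem stepVec_ae (n : ℕ) (j : Fin (n + 1)) :
    stepVec n j =ᵐ[vol01] (cell n j).indicator fun _ => √((n : ℝ) + 1) :=
  indicatorConstLp_coeFn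

theorem ae_stepVec_eq (n : ℕ) : ∀ᵐ t ∂vol01, ∃ j, t ∈ cell n j ∧
    ∀ k, stepVec n k t = if k = j then √((n : ℝ) + 1) else 0 := by
  filter_upwards [ae_restrict_mem measurableSet_Ioo, ae_all_iff.2 (stepVec_ae n)] with t ht hk
  obtain ⟨j, hj⟩ := exists_mem_cell n ht
  refine ⟨j, hj, fun k => ?_⟩
  rw [hk k]
  split_ifs with h
  · rw [h, Set.indicator_of_mem hj]
  · exact Set.indicator_of_notMem (fun hk => h (eq_of_mem_cell hk hj)) _

/-- Consequently `√(n + 1) * ⟪stepVec n j, x⟫` is the mean of `x` over the cell, which is also the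
value there of `stepProj n x`. -/
theorem integral_stepVec (n : ℕ) (j : Fin (n + 1)) :
    √((n : ℝ) + 1) * ∫ t, stepVec n j t ∂vol01 = 1 := by
  have hn : (0 : ℝ) < n + 1 := by positivity
  rw [integral_congr_ae (stepVec_ae n j), integral_indicator (measurableSet_cell n j),
    setIntegral_const, Measure.real, vol01_cell, ENNReal.toReal_ofReal (by positivity), smul_eq_mul]
  have : √((n : ℝ) + 1) * √((n : ℝ) + 1) = n + 1 := Real.mul_self_sqrt hn.le
  field_simp
  linarith

theorem inner_eq_integral_mul (x y : L01) : ⟪x, y⟫ = ∫ t, x t * y t ∂vol01 := by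
  rw [L2.inner_def]
  exact integral_congr_ae (ae_of_all _ fun t => by simp [mul_comm])

theorem orthonormal_stepVec (n : ℕ) : Orthonormal ℝ (stepVec n) := by
  rw [orthonormal_iff_ite]
  intro i j
  rw [inner_eq_integral_mul]
  split_ifs with h
  · subst h
    rw [← integral_stepVec n i, ← integral_const_mul]
    refine integral_congr_ae ?_
    filter_upwards [ae_stepVec_eq n] with t ⟨k, _, hk⟩
    rw [hk]
    split_ifs <;> simp
  · refine integral_eq_zero_of_ae ?_
    filter_upwards [ae_stepVec_eq n] with t ⟨k, _, hk⟩
    rw [hk, hk]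
    have : ¬ (i = k ∧ j = k) := fun h' => h (h'.1.trans h'.2.symm)
    by_cases h1 : i = k <;> simp_all

/-- The projection onto functions that are constant on each cell. -/
noncomputable def stepProj (n : ℕ) : L01 →L[ℝ] L01 :=
  ∑ j, (innerSL ℝ (stepVec n j)).smulRight (stepVec n j)

theorem stepProj_apply (n : ℕ) (f : L01) :
    stepProj n f = ∑ j, ⟪stepVec n j, f⟫ • stepVec n j := by
  simp [stepProj]

theorem norm_stepProj_le (n : ℕ) (f : L01) : ‖stepProj n f‖ ≤ ‖f‖ := by
  have h1 : ∀ j, ⟪stepVec n j, stepProj n f⟫ = ⟪stepVec n j, f⟫ := fun j => by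
    rw [stepProj_apply, (orthonormal_stepVec n).inner_right_fintype]
  -- With this identity, Cauchy–Schwarz gives `‖Pf‖² ≤ ‖Pf‖ ‖f‖`.
  have h2 : ⟪stepProj n f, stepProj n f⟫ = ⟪stepProj n f, f⟫ := by
    nth_rw 1 3 [stepProj_apply]
    simp_rw [sum_inner, real_inner_smul_left, h1]
  have h3 := real_inner_le_norm (stepProj n f) f
  rw [← h2, real_inner_self_eq_norm_sq] at h3
  by_contra! h
  nlinarith [norm_nonneg f, norm_nonneg (stepProj n f)]

/-- Linear combinations of the step vectors are evaluated cell by cell. -/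
theorem ae_sum_smul_stepVec (n : ℕ) (c : Fin (n + 1) → ℝ) : ∀ᵐ t ∂vol01, ∃ j, t ∈ cell n j ∧
    (∀ k, stepVec n k t = if k = j then √((n : ℝ) + 1) else 0) ∧
    (∑ k, c k • stepVec n k : L01) t = √((n : ℝ) + 1) * c j := by
  have h1 := Lp.coeFn_finsetSum Finset.univ fun k => c k • stepVec n k
  have h2 : ∀ᵐ t ∂vol01, ∀ k, (c k • stepVec n k : L01) t = c k * stepVec n k t :=
    ae_all_iff.2 fun k => Lp.coeFn_smul _ _
  filter_upwards [h1, h2, ae_stepVec_eq n] with t h1 h2 ⟨j, hj, hk⟩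
  refine ⟨j, hj, hk, ?_⟩
  rw [h1, Finset.sum_apply]
  simp_rw [h2, hk]
  simp [mul_comm]

theorem ae_stepProj (n : ℕ) (f : L01) : ∀ᵐ t ∂vol01, ∃ j, t ∈ cell n j ∧
    (∀ k, stepVec n k t = if k = j then √((n : ℝ) + 1) else 0) ∧
    stepProj n f t = √((n : ℝ) + 1) * ⟪stepVec n j, f⟫ := by
  rw [stepProj_apply]
  exact ae_sum_smul_stepVec n _

/-- At `t` the projection is the mean of `φ` over the cell of `t`, on which `φ` differs from `φ t`
by at most `K / (n + 1)`. -/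
theorem norm_stepProj_sub_le {R : L01} {φ : ℝ → ℝ} {K : NNReal} (hφ : LipschitzWith K φ)
    (hR : R =ᵐ[vol01] φ) (n : ℕ) : ‖stepProj n R - R‖ ≤ K * (1 / (n + 1)) := by
  have hint : ∀ x : L01, Integrable x vol01 := fun x => (Lp.memLp x).integrable (by norm_num)
  have hbd : ∀ᵐ t ∂vol01, ‖(stepProj n R - R : L01) t‖ ≤ K * (1 / (n + 1)) := by
    filter_upwards [Lp.coeFn_sub (stepProj n R) R, ae_stepProj n R, hR] with t h1 ⟨j, hj, _, h2⟩ h3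
    rw [h1, Pi.sub_apply, h2, h3, inner_eq_integral_mul]
    have e1 : φ t = √((n : ℝ) + 1) * ∫ s, stepVec n j s * φ t ∂vol01 := by
      rw [integral_mul_const, ← mul_assoc, integral_stepVec, one_mul]
    have i1 : Integrable (fun s => stepVec n j s * R s) vol01 := by
      refine (L2.integrable_inner (𝕜 := ℝ) (stepVec n j) R).congr (ae_of_all _ fun t => ?_)
      simp [mul_comm]
    have i2 : Integrable (fun s => stepVec n j s * φ t) vol01 := (hint _).mul_const _
    have i3 := (hint (stepVec n j)).mul_const (K * (1 / ((n : ℝ) + 1)))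
    rw [e1]
    rw [← mul_sub, ← integral_sub i1 i2, norm_mul, Real.norm_of_nonneg (Real.sqrt_nonneg _)]
    have hb : ‖∫ s, (stepVec n j s * R s - stepVec n j s * φ t) ∂vol01‖ ≤
        ∫ s, stepVec n j s * (K * (1 / ((n : ℝ) + 1))) ∂vol01 := by
      refine norm_integral_le_of_norm_le i3 ?_
      filter_upwards [stepVec_ae n j, hR] with s k1 k2
      rw [k1, k2, ← mul_sub, norm_mul]
      by_cases hs : s ∈ cell n j
      · rw [Set.indicator_of_mem hs, Real.norm_of_nonneg (Real.sqrt_nonneg _)]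
        have := hφ.dist_le_mul s t
        rw [Real.dist_eq, Real.dist_eq] at this
        have h5 := abs_sub_le_of_mem_cell hs hj
        rw [Real.norm_eq_abs]
        gcongr
        exact this.trans (by gcongr)
      · rw [Set.indicator_of_notMem hs]
        simp
    calc _ ≤ √((n : ℝ) + 1) * ∫ s, stepVec n j s * (K * (1 / ((n : ℝ) + 1))) ∂vol01 := by gcongr
      _ = _ := by rw [integral_mul_const, ← mul_assoc, integral_stepVec, one_mul]
  have := Lp.norm_le_of_ae_bound (by positivity) hbd
  simpa [measureUnivNNReal] using this

/-- Contractions that converge on the dense set of test functions, which are Lipschitz, converge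
everywhere. -/
theorem tendsto_stepProj (f : L01) : Tendsto (fun n => stepProj n f) atTop (𝓝 f) := by
  rw [Metric.tendsto_atTop]
  intro ε hε
  obtain ⟨R, hR, hd⟩ := Metric.mem_closure_iff.1 (dense_testFunctions01 f) (ε / 3) (by positivity)
  obtain ⟨φ, h1, h2, h3⟩ := hR
  obtain ⟨K, hK⟩ := (h1.of_le (by simp)).lipschitzWith_of_hasCompactSupport
    (hasCompactSupport_of_tsupport_subset_Ioo h2) (one_ne_zero)
  have ht : Tendsto (fun n : ℕ => (K : ℝ) * (1 / ((n : ℝ) + 1))) atTop (𝓝 0) := by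
    simpa using (tendsto_one_div_add_atTop_nhds_zero_nat (𝕜 := ℝ)).const_mul (K : ℝ)
  obtain ⟨N, hN⟩ := (ht.eventually_lt_const (by positivity : 0 < ε / 3)).exists_forall_of_atTop
  refine ⟨N, fun n hn => ?_⟩
  rw [dist_eq_norm] at hd ⊢
  have e : stepProj n f - f = stepProj n (f - R) + (stepProj n R - R) - (f - R) := by
    rw [map_sub]; abel
  rw [e]
  have a1 := norm_stepProj_le n (f - R)
  have a2 := (norm_stepProj_sub_le hK h3 n).trans_lt (hN n hn)
  calc _ ≤ ‖stepProj n (f - R)‖ + ‖stepProj n R - R‖ + ‖f - R‖ :=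
        (norm_sub_le _ _).trans (by gcongr; exact norm_add_le _ _)
    _ < ε := by linarith

/-! ### Multiplication by a bounded function of `f`. -/

section BoundedMultiplier

variable {b : ℝ → ℝ}

theorem memLp_bddMul (hb : Measurable b) (h1 : ∀ x, |b x| ≤ 1) (f η : L01) :
    MemLp (fun t => b (f t) * η t) 2 vol01 := by
  refine (Lp.memLp η).mono ((hb.comp_aemeasurable
    (Lp.aestronglyMeasurable f).aemeasurable).aestronglyMeasurable.mul
    (Lp.aestronglyMeasurable η)) (ae_of_all _ fun t => ?_)
  rw [norm_mul]
  exact mul_le_of_le_one_left (norm_nonneg _) (h1 _)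

/-- The product of `b ∘ f` and `η`, for `b` measurable and bounded by `1`. -/
noncomputable def bddMul (hb : Measurable b) (h1 : ∀ x, |b x| ≤ 1) (f η : L01) : L01 :=
  (memLp_bddMul hb h1 f η).toLp

theorem bddMul_ae (hb : Measurable b) (h1 : ∀ x, |b x| ≤ 1) (f η : L01) :
    bddMul hb h1 f η =ᵐ[vol01] fun t => b (f t) * η t :=
  (memLp_bddMul hb h1 f η).coeFn_toLp

theorem norm_bddMul_le (hb : Measurable b) (h1 : ∀ x, |b x| ≤ 1) (f η : L01) :
    ‖bddMul hb h1 f η‖ ≤ ‖η‖ := by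
  refine Lp.norm_le_norm_of_ae_le ?_
  filter_upwards [bddMul_ae hb h1 f η] with t ht
  rw [ht, norm_mul]
  exact mul_le_of_le_one_left (norm_nonneg _) (h1 _)

theorem tendsto_bddMul_of_tendsto_fun {c : ℕ → ℝ → ℝ} (hc : ∀ n, Measurable (c n))
    (hc1 : ∀ n x, |c n x| ≤ 1) (hb : Measurable b) (h1 : ∀ x, |b x| ≤ 1)
    (hlim : ∀ x, Tendsto (fun n => c n x) atTop (𝓝 (b x))) (f η : L01) :
    Tendsto (fun n => bddMul (hc n) (hc1 n) f η) atTop (𝓝 (bddMul hb h1 f η)) := by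
  refine tendsto_toLp_of_dominated _ _ (Lp.memLp η).norm (fun n => ae_of_all _ fun t => ?_)
    (ae_of_all _ fun t => (hlim _).mul_const _)
  rw [norm_mul]
  exact mul_le_of_le_one_left (norm_nonneg _) (hc1 _ _)

/-- Convergence in `L²` yields pointwise convergence only along subsequences, so every subsequence
is shown to have a further one with the right limit. -/
theorem tendsto_bddMul_of_tendsto (hb : Continuous b) (h1 : ∀ x, |b x| ≤ 1) {x : ℕ → L01}
    {f : L01} (hx : Tendsto x atTop (𝓝 f)) (η : L01) :
    Tendsto (fun n => bddMul hb.measurable h1 (x n) η) atTop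
      (𝓝 (bddMul hb.measurable h1 f η)) := by
  refine tendsto_of_subseq_tendsto fun ns hns => ?_
  obtain ⟨ms, -, hae⟩ := (tendstoInMeasure_of_tendsto_Lp (hx.comp hns)).exists_seq_tendsto_ae
  refine ⟨ms, tendsto_toLp_of_dominated _ _ (Lp.memLp η).norm (fun n => ae_of_all _ fun t => ?_) ?_⟩
  · rw [norm_mul]
    exact mul_le_of_le_one_left (norm_nonneg _) (h1 _)
  · filter_upwards [hae] with t ht
    exact ((hb.tendsto _).comp ht).mul_const _

end BoundedMultiplier

/-! ### Composition with a smooth function on step functions. -/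

section StepFunctions

variable {φ : ℝ → ℝ}

/-- The reason for using step functions: `φ` acts cell by cell, so the composition depends on
finitely many coordinates. The factor `√(n + 1)` turns a coefficient into a value, and the division
turns it back. -/
theorem compLp_stepProj (hL : LipschitzWith 1 φ) (h0 : φ 0 = 0) (n : ℕ) (f : L01) :
    hL.compLp h0 (stepProj n f) =
      ∑ j, (φ (√((n : ℝ) + 1) * ⟪stepVec n j, f⟫) / √((n : ℝ) + 1)) • stepVec n j := by
  have hn : √((n : ℝ) + 1) ≠ 0 := (Real.sqrt_pos.2 (by positivity)).ne'
  refine Lp.ext ?_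
  filter_upwards [hL.coeFn_compLp h0 (stepProj n f), ae_stepProj n f, ae_sum_smul_stepVec n
    fun j => φ (√((n : ℝ) + 1) * ⟪stepVec n j, f⟫) / √((n : ℝ) + 1)] with t h1 ⟨j, hj, _, h2⟩
    ⟨k, hk, _, h3⟩
  rw [h1, Function.comp_apply, h2, h3, eq_of_mem_cell hj hk, mul_div_cancel₀ _ hn]

theorem inner_stepVec_bddMul {b : ℝ → ℝ} (hb : Measurable b) (h1 : ∀ x, |b x| ≤ 1) (n : ℕ)
    (j : Fin (n + 1)) (f η : L01) : ⟪stepVec n j, bddMul hb h1 (stepProj n f) η⟫ =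
      b (√((n : ℝ) + 1) * ⟪stepVec n j, f⟫) * ⟪stepVec n j, η⟫ := by
  rw [inner_eq_integral_mul (stepVec n j) η, ← integral_const_mul, inner_eq_integral_mul]
  refine integral_congr_ae ?_
  filter_upwards [bddMul_ae hb h1 (stepProj n f) η, ae_stepProj n f] with t k1 ⟨i, _, k2, k3⟩
  rw [k1, k3, k2]
  split_ifs with h
  · rw [h]; ring
  · simp

/-- Chain rule for gradients of functions of finitely many real variables. -/
theorem HasGradientAt.comp_pi {k : ℕ} {g : (Fin k → ℝ) → ℝ} {y : Fin k → L01 → ℝ}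
    {v : Fin k → L01} {f : L01} (hg : DifferentiableAt ℝ g fun i => y i f)
    (hy : ∀ i, HasGradientAt (y i) (v i) f) :
    HasGradientAt (fun f => g fun i => y i f)
      (∑ i, fderiv ℝ g (fun i => y i f) (Pi.single i 1) • v i) f := by
  rw [hasGradientAt_iff_hasFDerivAt]
  have h1 : HasFDerivAt (fun f i => y i f)
      (ContinuousLinearMap.pi fun i => InnerProductSpace.toDual ℝ L01 (v i)) f :=
    hasFDerivAt_pi.2 fun i => (hy i).hasFDerivAt
  refine (hg.hasFDerivAt.comp f h1).congr_fderiv ?_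
  ext x
  have hsum : ∀ (ℓ : (Fin k → ℝ) →L[ℝ] ℝ) z, ℓ z = ∑ i, ℓ (Pi.single i 1) * z i := fun ℓ z => by
    conv_lhs => rw [← Finset.univ_sum_single z, map_sum]
    refine Finset.sum_congr rfl fun i _ => ?_
    rw [mul_comm, ← smul_eq_mul, ← map_smul, ← Pi.single_smul, smul_eq_mul, mul_one]
  rw [ContinuousLinearMap.comp_apply, hsum]
  simp

theorem hasGradientAt_inner (η f : L01) : HasGradientAt (fun f => ⟪η, f⟫) η f := by
  rw [hasGradientAt_iff_hasFDerivAt]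
  exact (innerSL ℝ η).hasFDerivAt

/-- Differentiating the finite sum of `compLp_stepProj` gives coefficients `φ'(value on the cell) *
⟪stepVec n j, η⟫`, which are the coordinates of `φ'(P_n f) η`. -/
theorem hasGradientAt_inner_compLp_stepProj (hφ : ContDiff ℝ (⊤ : ℕ∞) φ) (hL : LipschitzWith 1 φ)
    (h0 : φ 0 = 0) (hb : Measurable (deriv φ)) (h1 : ∀ x, |deriv φ x| ≤ 1) (n : ℕ) (η f : L01) :
    HasGradientAt (fun f => ⟪η, hL.compLp h0 (stepProj n f)⟫)
      (stepProj n (bddMul hb h1 (stepProj n f) η)) f := by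
  have hn : √((n : ℝ) + 1) ≠ 0 := (Real.sqrt_pos.2 (by positivity)).ne'
  rw [hasGradientAt_iff_hasFDerivAt]
  simp_rw [compLp_stepProj, inner_sum, real_inner_smul_right]
  have hj : ∀ j, HasFDerivAt (fun f : L01 => φ (√((n : ℝ) + 1) * ⟪stepVec n j, f⟫) /
      √((n : ℝ) + 1) * ⟪η, stepVec n j⟫) ((deriv φ (√((n : ℝ) + 1) * ⟪stepVec n j, f⟫) *
        ⟪stepVec n j, η⟫) • innerSL ℝ (stepVec n j)) f := fun j => by
    have k1 : HasFDerivAt (fun f : L01 => √((n : ℝ) + 1) * ⟪stepVec n j, f⟫)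
        (√((n : ℝ) + 1) • innerSL ℝ (stepVec n j)) f :=
      ((innerSL ℝ (stepVec n j)).hasFDerivAt (x := f)).const_mul _
    have k2 := (hφ.differentiable (by simp) (√((n : ℝ) + 1) * ⟪stepVec n j, f⟫)).hasDerivAt
    have k3 := (k2.comp_hasFDerivAt f k1).mul_const ((√((n : ℝ) + 1))⁻¹ * ⟪η, stepVec n j⟫)
    refine (k3.congr_fderiv ?_).congr_of_eventuallyEq (Eventually.of_forall fun f => ?_)
    · ext x
      simp [real_inner_comm η]
      field_simp
    · simp [div_eq_mul_inv, mul_assoc]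
  refine (HasFDerivAt.fun_sum fun j _ => hj j).congr_fderiv ?_
  rw [stepProj_apply]
  ext x
  simp [inner_stepVec_bddMul]

end StepFunctions

theorem IsCbInfty.exists_bound {k : ℕ} {g : (Fin k → ℝ) → ℝ} (hg : IsCbInfty g) :
    ∃ C, 0 ≤ C ∧ (∀ x, ‖g x‖ ≤ C) ∧ ∀ x i, |fderiv ℝ g x (Pi.single i 1)| ≤ C := by
  obtain ⟨C₀, h0⟩ := hg.2 0
  obtain ⟨C₁, h1⟩ := hg.2 1
  simp only [norm_iteratedFDeriv_zero] at h0
  simp only [norm_iteratedFDeriv_one] at h1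
  refine ⟨max C₀ C₁, ((norm_nonneg _).trans (h0 0)).trans (le_max_left _ _),
    fun x => (h0 x).trans (le_max_left _ _), fun x i => ?_⟩
  refine ((fderiv ℝ g x).le_opNorm _).trans ?_
  rw [Pi.norm_single, norm_one, mul_one]
  exact (h1 x).trans (le_max_right _ _)

/-! ### Passing from step functions to `L`, and from smooth functions to the absolute value. -/

section SmoothAbs

variable {k : ℕ} {g : (Fin k → ℝ) → ℝ} {φ : ℝ → ℝ}

theorem norm_sum_smul_le_of_bound {C : ℝ} {c : Fin k → ℝ} (hc : ∀ i, |c i| ≤ C)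
    {v η : Fin k → L01} (hv : ∀ i, ‖v i‖ ≤ ‖η i‖) : ‖∑ i, c i • v i‖ ≤ ∑ i, C * ‖η i‖ := by
  refine (norm_sum_le _ _).trans (Finset.sum_le_sum fun i _ => ?_)
  rw [norm_smul]
  have := (abs_nonneg _).trans (hc i)
  exact mul_le_mul (hc i) (hv i) (norm_nonneg _) this

/-- Weak gradient of a cylindrical function composed with a step function approximation. -/
theorem isWeakGradient_comp_stepProj (hg : IsCbInfty g) (η : Fin k → L01)
    (hφ : ContDiff ℝ (⊤ : ℕ∞) φ) (hL : LipschitzWith 1 φ) (h0 : φ 0 = 0)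
    (hb : Measurable (deriv φ)) (h1 : ∀ x, |deriv φ x| ≤ 1) (n : ℕ) :
    IsWeakGradient (fun f => g fun i => ⟪η i, hL.compLp h0 (stepProj n f)⟫)
      (fun f => ∑ i, fderiv ℝ g (fun i => ⟪η i, hL.compLp h0 (stepProj n f)⟫) (Pi.single i 1) •
        stepProj n (bddMul hb h1 (stepProj n f) (η i))) := by
  obtain ⟨C, hC0, hC, hC'⟩ := hg.exists_bound
  -- The coordinates are placed in a Euclidean space because the Fourier argument needs an inner
  -- product.
  let A : L01 →L[ℝ] EuclideanSpace ℝ (Fin (n + 1)) :=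
    (EuclideanSpace.equiv (Fin (n + 1)) ℝ).symm.toContinuousLinearMap.comp
      (ContinuousLinearMap.pi fun j => innerSL ℝ (stepVec n j))
  let G : EuclideanSpace ℝ (Fin (n + 1)) → ℝ := fun x => g fun i =>
    ∑ j, φ (√((n : ℝ) + 1) * x j) / √((n : ℝ) + 1) * ⟪η i, stepVec n j⟫
  have hA : ∀ f j, A f j = ⟪stepVec n j, f⟫ := fun f j => rfl
  have hGA : (fun f => g fun i => ⟪η i, hL.compLp h0 (stepProj n f)⟫) = fun f => G (A f) := by
    funext f
    simp only [G, hA, compLp_stepProj, inner_sum, real_inner_smul_right]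
  have hG : ContDiff ℝ (⊤ : ℕ∞) G := by
    refine hg.1.comp (contDiff_pi.2 fun i => ContDiff.sum fun j _ => ?_)
    refine ((hφ.comp (contDiff_const.mul ?_)).div_const _).mul contDiff_const
    exact contDiff_euclidean.1 contDiff_id j
  have hgrad : (∇ fun f => g fun i => ⟪η i, hL.compLp h0 (stepProj n f)⟫) =
      fun f => ∑ i, fderiv ℝ g (fun i => ⟪η i, hL.compLp h0 (stepProj n f)⟫) (Pi.single i 1) •
        stepProj n (bddMul hb h1 (stepProj n f) (η i)) :=
    gradient_eq fun f => HasGradientAt.comp_pi (hg.1.differentiable (by simp) _)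
      fun i => hasGradientAt_inner_compLp_stepProj hφ hL h0 hb h1 n (η i) f
  rw [← hgrad, hGA]
  refine isWeakGradient_of_bounded A hG (C := max C (∑ i, C * ‖η i‖))
    (fun f => (hC _).trans (le_max_left _ _)) (fun f => ?_)
  rw [← hGA, hgrad]
  refine le_trans ?_ (le_max_right _ _)
  exact norm_sum_smul_le_of_bound (fun i => hC' _ i) fun i =>
    (norm_stepProj_le _ _).trans (norm_bddMul_le _ _ _ _)

theorem isWeakGradient_comp_smooth (hg : IsCbInfty g) (η : Fin k → L01)
    (hφ : ContDiff ℝ (⊤ : ℕ∞) φ) (hL : LipschitzWith 1 φ) (h0 : φ 0 = 0)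
    (hb : Measurable (deriv φ)) (h1 : ∀ x, |deriv φ x| ≤ 1) :
    IsWeakGradient (fun f => g fun i => ⟪η i, hL.compLp h0 f⟫)
      (fun f => ∑ i, fderiv ℝ g (fun i => ⟪η i, hL.compLp h0 f⟫) (Pi.single i 1) •
        bddMul hb h1 f (η i)) := by
  obtain ⟨C, hC0, hC, hC'⟩ := hg.exists_bound
  have hy : ∀ f : L01, Tendsto (fun n i => ⟪η i, hL.compLp h0 (stepProj n f)⟫) atTop
      (𝓝 fun i => ⟪η i, hL.compLp h0 f⟫) := fun f =>
    tendsto_pi_nhds.2 fun i => tendsto_const_nhds.inner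
      (((hL.continuous_compLp h0).tendsto f).comp (tendsto_stepProj f))
  have hdc : Continuous (deriv φ) := hφ.continuous_deriv (by simp)
  refine IsWeakGradient.of_tendsto (C := max C (∑ i, C * ‖η i‖))
    (isWeakGradient_comp_stepProj hg η hφ hL h0 hb h1) (fun n f => (hC _).trans (le_max_left _ _))
    (fun n f => le_trans ?_ (le_max_right _ _))
    (fun f => (hg.1.continuous.tendsto _).comp (hy f)) (fun f => ?_)
  · exact norm_sum_smul_le_of_bound (fun i => hC' _ i) fun i =>
      (norm_stepProj_le _ _).trans (norm_bddMul_le _ _ _ _)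
  · refine tendsto_finsetSum _ fun i _ => Tendsto.smul ?_ ?_
    · have hcont : Continuous fun y => fderiv ℝ g y (Pi.single i 1) :=
        (hg.1.continuous_fderiv (by simp)).clm_apply continuous_const
      exact (hcont.tendsto _).comp (hy f)
    · have k1 := tendsto_bddMul_of_tendsto hdc h1 (tendsto_stepProj f) (η i)
      -- Projection and argument both vary with `n`; contractivity of `stepProj n` handles the
      -- change of argument.
      have k2 : Tendsto (fun n => stepProj n (bddMul hb h1 (stepProj n f) (η i) -
          bddMul hb h1 f (η i))) atTop (𝓝 0) :=
        squeeze_zero_norm (fun n => norm_stepProj_le n _)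
          (by simpa using (tendsto_iff_norm_sub_tendsto_zero.1 k1))
      have k3 := k2.add (tendsto_stepProj (bddMul hb h1 f (η i)))
      simpa only [map_sub, sub_add_cancel, zero_add] using k3

/-- A smooth approximation of the absolute value. -/
noncomputable def smoothAbs (ε x : ℝ) : ℝ := √(x ^ 2 + ε ^ 2) - ε

variable {ε : ℝ}

theorem sq_add_sq_pos (hε : 0 < ε) (x : ℝ) : 0 < x ^ 2 + ε ^ 2 := by positivity

theorem contDiff_smoothAbs (hε : 0 < ε) : ContDiff ℝ (⊤ : ℕ∞) (smoothAbs ε) := by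
  refine ContDiff.sub (ContDiff.sqrt (by fun_prop) fun x => (sq_add_sq_pos hε x).ne')
    contDiff_const

theorem deriv_smoothAbs (hε : 0 < ε) (x : ℝ) :
    deriv (smoothAbs ε) x = x / √(x ^ 2 + ε ^ 2) := by
  have h := ((((hasDerivAt_id x).pow 2).add_const (ε ^ 2)).sqrt
    (sq_add_sq_pos hε x).ne').sub_const ε
  refine (h.deriv).trans ?_
  have := (Real.sqrt_pos.2 (sq_add_sq_pos hε x)).ne'
  simp
  field_simp

theorem abs_deriv_smoothAbs_le (hε : 0 < ε) (x : ℝ) : |deriv (smoothAbs ε) x| ≤ 1 := by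
  rw [deriv_smoothAbs hε, abs_div, abs_of_nonneg (Real.sqrt_nonneg _),
    div_le_one (Real.sqrt_pos.2 (sq_add_sq_pos hε x))]
  exact Real.abs_le_sqrt (by nlinarith [sq_nonneg ε])

/-- The subtraction of `ε` in `smoothAbs` secures this condition, which `compLp` requires. -/
theorem smoothAbs_zero (hε : 0 < ε) : smoothAbs ε 0 = 0 := by
  simp [smoothAbs, Real.sqrt_sq hε.le]

theorem lipschitzWith_smoothAbs (hε : 0 < ε) : LipschitzWith 1 (smoothAbs ε) :=
  lipschitzWith_of_nnnorm_deriv_le ((contDiff_smoothAbs hε).differentiable (by simp)) fun x => by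
    rw [← NNReal.coe_le_coe]
    exact abs_deriv_smoothAbs_le hε x

theorem abs_smoothAbs_sub_abs_le (hε : 0 < ε) (x : ℝ) : |smoothAbs ε x - abs x| ≤ ε := by
  have h1 : |x| ≤ √(x ^ 2 + ε ^ 2) := Real.abs_le_sqrt (by nlinarith [sq_nonneg ε])
  have h2 : √(x ^ 2 + ε ^ 2) ≤ |x| + ε := by
    rw [Real.sqrt_le_left (by positivity)]
    nlinarith [sq_abs x, abs_nonneg x]
  rw [smoothAbs, abs_le]
  constructor <;> linarith

/-- Convergence holds for every `x`: at `0` all the derivatives vanish, in agreement with `Real.sign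
0 = 0`. The zero set of `f` therefore needs no separate treatment. -/
theorem tendsto_deriv_smoothAbs {c : ℕ → ℝ} (hc : ∀ n, 0 < c n) (hlim : Tendsto c atTop (𝓝 0))
    (x : ℝ) : Tendsto (fun n => deriv (smoothAbs (c n)) x) atTop (𝓝 (Real.sign x)) := by
  simp_rw [deriv_smoothAbs (hc _)]
  rcases eq_or_ne x 0 with rfl | hx
  · simp
  have h1 : Tendsto (fun n => x / √(x ^ 2 + c n ^ 2)) atTop (𝓝 (x / √(x ^ 2 + 0 ^ 2))) := by
    refine tendsto_const_nhds.div ?_ ?_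
    · exact (tendsto_const_nhds.add (hlim.pow 2)).sqrt
    · simpa [Real.sqrt_sq_eq_abs] using hx
  convert h1 using 2
  rw [zero_pow two_ne_zero, add_zero, Real.sqrt_sq_eq_abs]
  rcases lt_or_gt_of_ne hx with h | h
  · rw [Real.sign_of_neg h, abs_of_neg h, div_neg, div_self hx]
  · rw [Real.sign_of_pos h, abs_of_pos h, div_self hx]

theorem norm_compLp_smoothAbs_sub_abs_le (hε : 0 < ε) (f : L01) :
    ‖(lipschitzWith_smoothAbs hε).compLp (smoothAbs_zero hε) f - |f|‖ ≤ ε := by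
  have := Lp.norm_le_of_ae_bound
    (f := (lipschitzWith_smoothAbs hε).compLp (smoothAbs_zero hε) f - |f|) hε.le (by
      filter_upwards [Lp.coeFn_sub ((lipschitzWith_smoothAbs hε).compLp (smoothAbs_zero hε) f) |f|,
        (lipschitzWith_smoothAbs hε).coeFn_compLp (smoothAbs_zero hε) f, Lp.coeFn_abs f]
        with t h1 h2 h3
      rw [h1, Pi.sub_apply, h2, h3]
      exact abs_smoothAbs_sub_abs_le hε _)
  simpa [measureUnivNNReal] using this

theorem measurable_real_sign : Measurable Real.sign := by
  unfold Real.sign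
  exact Measurable.ite measurableSet_Iio measurable_const
    (Measurable.ite measurableSet_Ioi measurable_const measurable_const)

theorem abs_real_sign_le_one (x : ℝ) : |Real.sign x| ≤ 1 := by
  rcases Real.sign_apply_eq x with h | h | h <;> simp [h]

/-- Weak gradient of a cylindrical function composed with the absolute value. -/
theorem isWeakGradient_comp_abs (hg : IsCbInfty g) (η : Fin k → L01) :
    IsWeakGradient (fun f => g fun i => ⟪η i, |f|⟫)
      (fun f => ∑ i, fderiv ℝ g (fun i => ⟪η i, |f|⟫) (Pi.single i 1) •
        bddMul measurable_real_sign abs_real_sign_le_one f (η i)) := by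
  obtain ⟨C, hC0, hC, hC'⟩ := hg.exists_bound
  let c : ℕ → ℝ := fun n => 1 / ((n : ℝ) + 1)
  have hc0 : ∀ n, 0 < c n := fun n => by positivity
  have hct : Tendsto c atTop (𝓝 0) := tendsto_one_div_add_atTop_nhds_zero_nat
  have hm : ∀ n, Measurable (deriv (smoothAbs (c n))) := fun n => measurable_deriv _
  have hy : ∀ f : L01, Tendsto (fun n i => ⟪η i, (lipschitzWith_smoothAbs (hc0 n)).compLp
      (smoothAbs_zero (hc0 n)) f⟫) atTop (𝓝 fun i => ⟪η i, |f|⟫) := fun f =>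
    tendsto_pi_nhds.2 fun i => tendsto_const_nhds.inner
      (tendsto_iff_norm_sub_tendsto_zero.2 (squeeze_zero (fun n => norm_nonneg _)
        (fun n => norm_compLp_smoothAbs_sub_abs_le (hc0 n) f) hct))
  refine IsWeakGradient.of_tendsto (C := max C (∑ i, C * ‖η i‖))
    (fun n => isWeakGradient_comp_smooth hg η (contDiff_smoothAbs (hc0 n))
      (lipschitzWith_smoothAbs (hc0 n)) (smoothAbs_zero (hc0 n)) (hm n)
      (abs_deriv_smoothAbs_le (hc0 n))) (fun n f => (hC _).trans (le_max_left _ _))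
    (fun n f => le_trans ?_ (le_max_right _ _))
    (fun f => (hg.1.continuous.tendsto _).comp (hy f)) (fun f => ?_)
  · exact norm_sum_smul_le_of_bound (fun i => hC' _ i) fun i => norm_bddMul_le _ _ _ _
  · refine tendsto_finsetSum _ fun i _ => Tendsto.smul ?_ ?_
    · have hcont : Continuous fun y => fderiv ℝ g y (Pi.single i 1) :=
        (hg.1.continuous_fderiv (by simp)).clm_apply continuous_const
      exact (hcont.tendsto _).comp (hy f)
    · exact tendsto_bddMul_of_tendsto_fun hm (fun n => abs_deriv_smoothAbs_le (hc0 n)) _ _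
        (tendsto_deriv_smoothAbs hc0 hct) f (η i)

end SmoothAbs

/-! ### Identification of the limit gradient and conclusion. -/

theorem gradient_cylindrical {k : ℕ} {g : (Fin k → ℝ) → ℝ} (hg : IsCbInfty g) (η : Fin k → L01)
    (f : L01) : ∇ (fun f => g fun i => ⟪η i, f⟫) f =
      ∑ i, fderiv ℝ g (fun i => ⟪η i, f⟫) (Pi.single i 1) • η i :=
  (HasGradientAt.comp_pi (hg.1.differentiable (by simp) _) fun i =>
    hasGradientAt_inner (η i) f).gradient

theorem exists_sobolevW12_comp_abs {F : L01 → ℝ} (hF : F ∈ cylindricalCbInfty) :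
    ∃ u ∈ sobolevW12, (u =ᵐ[brownianBridgeLaw] fun f => F |f|) ∧
      ∀ᵐ f ∂brownianBridgeLaw,
        weakGradient u f =ᵐ[vol01] fun t => Real.sign (f t) * (∇ F |f|) t := by
  obtain ⟨k, g, η, hg, rfl⟩ := hF
  obtain ⟨hU, hV, hw⟩ := isWeakGradient_comp_abs hg η
  refine ⟨hU.toLp, ⟨_, hw⟩, hU.coeFn_toLp, ?_⟩
  rw [hw.weakGradient_eq]
  filter_upwards [hV.coeFn_toLp] with f hf
  rw [hf, gradient_cylindrical hg]
  set c : Fin k → ℝ := fun i => fderiv ℝ g (fun i => ⟪η i, |f|⟫) (Pi.single i 1)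
  have h1 := Lp.coeFn_finsetSum Finset.univ fun i =>
    c i • bddMul measurable_real_sign abs_real_sign_le_one f (η i)
  have h2 := Lp.coeFn_finsetSum Finset.univ fun i => c i • η i
  have h3 : ∀ᵐ t ∂vol01, ∀ i, (c i • bddMul measurable_real_sign abs_real_sign_le_one f (η i) : L01) t
      = c i * bddMul measurable_real_sign abs_real_sign_le_one f (η i) t :=
    ae_all_iff.2 fun i => Lp.coeFn_smul _ _
  have h4 : ∀ᵐ t ∂vol01, ∀ i, (c i • η i : L01) t = c i * η i t :=
    ae_all_iff.2 fun i => Lp.coeFn_smul _ _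
  have h5 : ∀ᵐ t ∂vol01, ∀ i, bddMul measurable_real_sign abs_real_sign_le_one f (η i) t =
      Real.sign (f t) * η i t := ae_all_iff.2 fun i => bddMul_ae _ _ _ _
  filter_upwards [h1, h2, h3, h4, h5] with t h1 h2 h3 h4 h5
  rw [h1, h2, Finset.sum_apply, Finset.sum_apply, Finset.mul_sum]
  refine Finset.sum_congr rfl fun i _ => ?_
  rw [h3, h4, h5]
  ring

theorem theorem4p2 :
    -- the weak gradient is well defined
    (∀ u v v', HasWeakGradient u v → HasWeakGradient u v' → v = v') ∧
    -- `F ∘ |·| ∈ W^{1,2}`, with weak gradient `sgn(·) ∇F ∘ |·|`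
    (∀ F ∈ cylindricalCbInfty, ∃ u ∈ sobolevW12,
      (u =ᵐ[brownianBridgeLaw] fun f => F |f|) ∧
      ∀ᵐ f ∂brownianBridgeLaw,
        weakGradient u f =ᵐ[vol01] fun t => Real.sign (f t) * (∇ F |f|) t) ∧
    -- `exp(C^∞)` is contained in and dense in `W^{1,2}`
    (∀ F ∈ expSmooth, ∃ w ∈ sobolevW12, w =ᵐ[brownianBridgeLaw] F) ∧
    (∀ u ∈ sobolevW12, ∀ ε > (0 : ℝ), ∃ F ∈ expSmooth, ∃ w ∈ sobolevW12,
      w =ᵐ[brownianBridgeLaw] F ∧ sobolevNorm (u - w) < ε) := by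
  exact ⟨fun u v v' h h' => h.unique h', fun F hF => exists_sobolevW12_comp_abs hF,
    fun F hF => exists_mem_sobolevW12_of_mem_expSmooth hF,
    fun u hu ε hε => exists_expSmooth_sobolevNorm_sub_lt hu hε⟩
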